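/- Let $k$ be a perfect field. A variety over $k$ is a reduced separated $k$-scheme of finite type, not necessarily irreducible. Let $V$ be an irreducible variety over $k$, let $W$ be a (possibly reducible) variety over $k$, and let $\mathfrak g$ be a finite abelian group acting faithfully on $W$ by $k$-automorphisms such that $V = W/\mathfrak g$, with quotient morphism $\pi : W \to V$; that is, $\pi$ is affine and $\mathfrak g$-invariant and $\mathcal O_V = (\pi_*\mathcal O_W)^{\mathfrak g}$. (This includes every abelian covering $\pi : W \to V$ with Galois group $\mathfrak g$, where moreover $\mathfrak g$ is required to be the group of all automorphisms of $W$ over $V$.) Let $G'$ be the group of units of the group algebra of $\mathfrak g$, that is, the open subscheme of the affine space $\mathbb A^{\mathfrak g}_k$ where the determinant $\det(x_{st^{-1}})_{s,t\in\mathfrak g}$ does not vanish, with the group law for which $G'(T) = (\Gamma(T,\mathcal O_T)[\mathfrak g])^\times$ for all $k$-schemes $T$. The group $\mathfrak g \subset G'(k)$ acts on $G'$ by translations. Then there are a group scheme $G$ over $k$ and a homomorphism $\theta : G' \to G$ of $k$-group schemes such that: 1. $\theta$ is an isogeny of connected commutative algebraic groups over $k$: $G'$ and $G$ are commutative group schemes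 over $k$ which are connected varieties, and $\theta$ is surjective with finite kernel. 2. $\theta$ is an abelian covering with Galois group $\mathfrak g$: $G = G'/\mathfrak g$ with quotient morphism $\theta$, the action of $\mathfrak g$ on $G'$ is faithful, and every automorphism of $G'$ over $G$ is the translation by an element of $\mathfrak g$. 3. There are rational maps $f : V \dashrightarrow G$ and $g : W \dashrightarrow G'$ over $k$ such that $$\begin{array}{ccc} W & \overset{g}{\dashrightarrow} & G' \\ {\scriptstyle\pi}\downarrow & & \downarrow{\scriptstyle\theta} \\ V & \overset{f}{\dashrightarrow} & G \end{array}$$ is a pullback diagram compatible with the actions of $\mathfrak g$: there is a dense open subset $U \subseteq V$ such that $\pi^{-1}(U)$ is dense in $W$, $f$ is represented by a morphism $U \to G$ and $g$ by a $\mathfrak g$-equivariant morphism $\pi^{-1}(U) \to G'$, and these make $\pi^{-1}(U)$ the fibre product $U \times_G G'$. -/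

import Mathlib

open CategoryTheory AlgebraicGeometry MonoidalCategory CartesianMonoidalCategory MonObj Opposite
universe u

namespace GroupAlgebra

section Ring
variable {R R' : Type*} [CommRing R] [CommRing R'] {𝔤 : Type*} [CommGroup 𝔤] [Fintype 𝔤]
  [DecidableEq 𝔤]

/-- The element `∑ s, v s • s` of the group algebra `R[𝔤]`. -/
noncomputable def elt (v : 𝔤 → R) : MonoidAlgebra R 𝔤 :=
  MonoidAlgebra.ofCoeff (Finsupp.equivFunOnFinite.symm v)

/-- The determinant `det (v (s t⁻¹))_{s,t}`; this is the determinant of multiplication by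
`∑ s, v s • s` on the group algebra `R[𝔤]`, in the basis `𝔤`. -/
def det (v : 𝔤 → R) : R := Matrix.det (Matrix.of fun s t : 𝔤 => v (s * t⁻¹))

lemma map_det (φ : R →+* R') (v : 𝔤 → R) : φ (det v) = det (φ ∘ v) := by
  rw [det, det, RingHom.map_det]; rfl

lemma det_eq (v : 𝔤 → R) :
    det v = (Algebra.leftMulMatrix (MonoidAlgebra.basis 𝔤 R) (elt v)).det := by
  rw [det]
  congr 1
  ext s t
  rw [Algebra.leftMulMatrix_eq_repr_mul, MonoidAlgebra.basis_apply]
  have : (elt v * MonoidAlgebra.single t 1).coeff s = v (s * t⁻¹) := by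
    rw [MonoidAlgebra.coeff_mul_single_eq_coeff_mul (m₂ := s * t⁻¹)]
    · simp [elt]
    · intro a _; rw [eq_mul_inv_iff_mul_eq]
  exact this.symm

lemma isUnit_det_iff (v : 𝔤 → R) : IsUnit (det v) ↔ IsUnit (elt v) := by
  rw [det_eq, ← Matrix.isUnit_iff_isUnit_det]
  constructor
  · intro h
    have hs : Function.Surjective (Algebra.lmul R (MonoidAlgebra R 𝔤) (elt v)) := by
      rw [Algebra.leftMulMatrix_apply] at h
      have := (isUnit_map_iff (LinearMap.toMatrixAlgEquiv (MonoidAlgebra.basis 𝔤 R))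
        (Algebra.lmul R (MonoidAlgebra R 𝔤) (elt v))).1 h
      exact ((Module.End.isUnit_iff _).1 this).2
    obtain ⟨y, hy⟩ := hs 1
    exact IsUnit.of_mul_eq_one y hy
  · intro h
    exact h.map (Algebra.leftMulMatrix (MonoidAlgebra.basis 𝔤 R))
end Ring

section Scheme
variable (S : Scheme.{u}) (𝔤 : Type u) [CommGroup 𝔤] [Fintype 𝔤] [DecidableEq 𝔤]

/-- The group of units of the group algebra of `𝔤`, as a scheme over `S`: the group algebra is
regarded as the affine space `𝔸(𝔤; S)`, and its units are the open subscheme on which the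
determinant `det (x (s t⁻¹))_{s,t}` is invertible. -/
noncomputable def unitGroup : Over S :=
  Over.mk ((𝔸(𝔤; S).basicOpen (det (AffineSpace.coord S))).ι ≫ 𝔸(𝔤; S) ↘ S)

/-- The open immersion of `unitGroup S 𝔤` into the affine space of the group algebra. -/
noncomputable def incl : (unitGroup S 𝔤).left ⟶ 𝔸(𝔤; S) :=
  (𝔸(𝔤; S).basicOpen (det (AffineSpace.coord S))).ι

instance : IsOpenImmersion (incl S 𝔤) :=
  inferInstanceAs (IsOpenImmersion (𝔸(𝔤; S).basicOpen (det (AffineSpace.coord S))).ι)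

@[simp] lemma incl_over : incl S 𝔤 ≫ 𝔸(𝔤; S) ↘ S = (unitGroup S 𝔤).hom := rfl

lemma range_incl :
    Set.range (incl S 𝔤) = (𝔸(𝔤; S).basicOpen (det (AffineSpace.coord S)) : Set 𝔸(𝔤; S)) :=
  Scheme.Opens.range_ι _

variable {S 𝔤}

/-- The coordinates of a `T`-valued point of `unitGroup S 𝔤`. -/
noncomputable def coords {T : Over S} (f : T ⟶ unitGroup S 𝔤) (s : 𝔤) : Γ(T.left, ⊤) :=
  (f.left ≫ incl S 𝔤).appTop (AffineSpace.coord S s)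

lemma basicOpen_eq_top_iff (X : Scheme.{u}) (a : Γ(X, ⊤)) : X.basicOpen a = ⊤ ↔ IsUnit a := by
  refine ⟨fun h => ?_, fun h => X.basicOpen_of_isUnit h⟩
  refine X.toRingedSpace.isUnit_of_isUnit_germ _ a fun x hx => ?_
  rw [← Scheme.mem_basicOpen_top, h]
  trivial

lemma isUnit_det_coords {T : Over S} (f : T ⟶ unitGroup S 𝔤) : IsUnit (det (coords f)) := by
  have h : det (coords f) = (f.left ≫ incl S 𝔤).appTop (det (AffineSpace.coord S)) :=
    (map_det (f.left ≫ incl S 𝔤).appTop.hom _).symm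
  rw [h, ← basicOpen_eq_top_iff, ← Scheme.preimage_basicOpen_top, eq_top_iff]
  intro x _
  have hx : incl S 𝔤 (f.left x) ∈ Set.range (incl S 𝔤) := ⟨_, rfl⟩
  rw [range_incl] at hx
  exact hx

lemma coords_comp {T T' : Over S} (g : T' ⟶ T) (f : T ⟶ unitGroup S 𝔤) (s : 𝔤) :
    coords (g ≫ f) s = g.left.appTop (coords f s) := by
  rw [coords, coords, Over.comp_left, Category.assoc, Scheme.Hom.comp_appTop]
  rfl

/-- The point of `unitGroup S 𝔤` with given coordinates. -/
noncomputable def ofCoords {T : Over S} (v : 𝔤 → Γ(T.left, ⊤)) (hv : IsUnit (det v)) :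
    T ⟶ unitGroup S 𝔤 :=
  Over.homMk (IsOpenImmersion.lift (incl S 𝔤) (AffineSpace.homOfVector T.hom v) (by
      rw [range_incl]
      rintro _ ⟨x, rfl⟩
      suffices h : (AffineSpace.homOfVector T.hom v) ⁻¹ᵁ
          (𝔸(𝔤; S).basicOpen (det (AffineSpace.coord S))) = ⊤ from h.ge (Set.mem_univ x)
      rw [Scheme.preimage_basicOpen_top]
      have : (AffineSpace.homOfVector T.hom v).appTop (det (AffineSpace.coord S)) = det v := by
        refine (map_det (AffineSpace.homOfVector T.hom v).appTop.hom _).trans ?_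
        congr 1
        funext s
        exact AffineSpace.homOfVector_appTop_coord _ _ _
      rw [this, (basicOpen_eq_top_iff _ _).2 hv])) (by rw [← incl_over, IsOpenImmersion.lift_fac_assoc, AffineSpace.homOfVector_over])

lemma coords_ofCoords {T : Over S} (v : 𝔤 → Γ(T.left, ⊤)) (hv : IsUnit (det v)) :
    coords (ofCoords v hv) = v := by
  funext s
  have h : (ofCoords v hv).left ≫ incl S 𝔤 = AffineSpace.homOfVector T.hom v :=
    IsOpenImmersion.lift_fac _ _ _
  rw [coords, h]
  exact AffineSpace.homOfVector_appTop_coord _ _ _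

lemma coords_injective {T : Over S} : Function.Injective (coords (T := T) (𝔤 := 𝔤)) := by
  intro f g h
  ext1
  rw [← cancel_mono (incl S 𝔤)]
  apply AffineSpace.hom_ext
  · rw [Category.assoc, Category.assoc, incl_over, Over.w f, Over.w g]
  · intro s
    exact congrFun h s

variable (S 𝔤)

/-- The functor of units of the group algebra, `T ↦ (Γ(T, 𝒪_T)[𝔤])ˣ`, on schemes over `S`. -/
noncomputable def unitsFunctor : (Over S)ᵒᵖ ⥤ CommGrpCat.{u} where
  obj T := CommGrpCat.of (MonoidAlgebra Γ(T.unop.left, ⊤) 𝔤)ˣ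
  map f := CommGrpCat.ofHom
    (Units.map (MonoidAlgebra.mapRingHom 𝔤 f.unop.left.appTop.hom).toMonoidHom)
  map_id T := by
    ext x : 3
    simp
  map_comp f g := by
    ext x : 3
    apply MonoidAlgebra.ext
    ext s
    simp
    rfl

/-- The scheme `unitGroup S 𝔤` represents the functor of units of the group algebra: the unit
corresponding to a point is the one whose coefficients are the coordinates of the point. -/
noncomputable def unitGroupRepresentableBy :
    (unitsFunctor S 𝔤 ⋙ forget _).RepresentableBy (unitGroup S 𝔤) where
  homEquiv {T} :=
    { toFun f := ((isUnit_det_iff _).1 (isUnit_det_coords f)).unit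
      invFun x := ofCoords (T := T) (Units.val x).coeff ((isUnit_det_iff _).2 (by
        have : elt ((Units.val x).coeff : 𝔤 → Γ(T.left, ⊤)) = x.val := by
          apply MonoidAlgebra.ext
          ext; simp [elt]
        rw [this]; exact Units.isUnit x))
      left_inv f := by
        apply coords_injective
        rw [coords_ofCoords]
        ext s; simp [elt]
      right_inv x := by
        apply Units.ext
        apply MonoidAlgebra.ext
        ext s
        simp [elt, coords_ofCoords] }
  homEquiv_comp g f := by
    apply Units.ext
    apply MonoidAlgebra.ext
    ext s
    exact coords_comp g f s

noncomputable instance : CommGrpObj (unitGroup S 𝔤) :=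
  CommGrpObj.ofRepresentableBy _ _ (unitGroupRepresentableBy S 𝔤)

variable {S 𝔤} in
/-- The `T`-valued points of `unitGroup S 𝔤` are the units of `Γ(T, 𝒪_T)[𝔤]`, as a group. -/
noncomputable def pointsEquiv {T : Over S} :
    (T ⟶ unitGroup S 𝔤) ≃* (MonoidAlgebra Γ(T.left, ⊤) 𝔤)ˣ where
  toEquiv := (unitGroupRepresentableBy S 𝔤).homEquiv
  map_mul' f g := ((yonedaGrpObjIsoOfRepresentableBy (unitGroup S 𝔤)
    (unitsFunctor S 𝔤 ⋙ forget₂ _ _) (unitGroupRepresentableBy S 𝔤)).hom.app (op T)).hom.map_mul f g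

lemma coeff_pointsEquiv {T : Over S} (f : T ⟶ unitGroup S 𝔤) (s : 𝔤) :
    (pointsEquiv f).val.coeff s = coords f s := rfl

/-- The rational points of `unitGroup S 𝔤` given by the elements of `𝔤`, which are units of the
group algebra. -/
noncomputable def point : 𝔤 →* (𝟙_ (Over S) ⟶ unitGroup S 𝔤) :=
  pointsEquiv.symm.toMonoidHom.comp
    ((Units.map (MonoidAlgebra.of Γ((𝟙_ (Over S)).left, ⊤) 𝔤)).comp toUnits.toMonoidHom)

/-- The action of `𝔤` on `unitGroup S 𝔤` by translations. -/
noncomputable def translation : 𝔤 →* Aut (unitGroup S 𝔤) where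
  toFun s := GrpObj.mulRight (point S 𝔤 s)
  map_one' := by
    ext1; rw [map_one]; exact congrArg Iso.hom (GrpObj.mulRight_one (unitGroup S 𝔤))
  map_mul' s t := by
    ext1
    have h (s : 𝔤) : (GrpObj.mulRight (point S 𝔤 s)).hom =
        𝟙 (unitGroup S 𝔤) * toUnit _ ≫ point S 𝔤 s := rfl
    change _ = (GrpObj.mulRight (point S 𝔤 t)).hom ≫ (GrpObj.mulRight (point S 𝔤 s)).hom
    rw [h, h, h, mul_comm s, map_mul, MonObj.comp_mul, MonObj.comp_mul, Category.comp_id,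
      ← Category.assoc, toUnit_unique (_ ≫ _) (toUnit _), _root_.mul_assoc]

end Scheme
end GroupAlgebra

namespace AlgebraicVariety
variable {k : Type u} [Field k]

/-- A variety over `k`: a reduced separated scheme of finite type over `k`
(not necessarily irreducible). -/
structure IsVariety (X : Over (Spec (.of k))) : Prop where
  isReduced : IsReduced X.left
  isSeparated : IsSeparated X.hom
  locallyOfFiniteType : LocallyOfFiniteType X.hom
  quasiCompact : QuasiCompact X.hom

/-- A connected commutative algebraic group over `k`: a commutative group object in `k`-schemes
which is a connected variety. -/
structure IsConnectedCommAlgGroup (G : Over (Spec (.of k))) [GrpObj G] : Prop where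
  isCommMonObj : IsCommMonObj G
  isVariety : IsVariety G
  connectedSpace : ConnectedSpace G.left

/-- An isogeny of connected commutative algebraic groups: a homomorphism which is surjective and
has finite kernel. -/
structure IsIsogeny {G' G : Over (Spec (.of k))} [GrpObj G'] [GrpObj G] (θ : G' ⟶ G) : Prop where
  source : IsConnectedCommAlgGroup G'
  target : IsConnectedCommAlgGroup G
  isMonHom : IsMonHom θ
  surjective : Surjective θ.left
  finite_kernel : IsFinite (Limits.pullback.snd θ.left η[G].left)

section Quotient
variable {𝔤 : Type*} [Group 𝔤] {W V : Over (Spec (.of k))}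

/-- A regular function `a` on an open subset `O` of `W` is invariant under the action `ρ` of `𝔤`
(in particular, `O` has to be stable under `𝔤`). -/
def IsInvariantSection (ρ : 𝔤 →* Aut W) (O : W.left.Opens) (a : Γ(W.left, O)) : Prop :=
  ∀ s : 𝔤, ∃ h : O ≤ (ρ s).hom.left ⁻¹ᵁ O, (ρ s).hom.left.appLE O O h a = a

/-- `π : W ⟶ V` exhibits `V` as the quotient `W / 𝔤` of `W` by the action `ρ` of the finite
group `𝔤`: the morphism `π` is affine and `𝔤`-invariant, and `𝒪_V` is, via `π`, the subsheaf of
`𝔤`-invariants of `π_* 𝒪_W`. (It follows that `π` is integral and surjective, that its fibres are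
the orbits of `𝔤`, and that `V` carries the quotient topology.) -/
structure IsQuotientBy (ρ : 𝔤 →* Aut W) (π : W ⟶ V) : Prop where
  isAffineHom : IsAffineHom π.left
  invariant : ∀ s : 𝔤, (ρ s).hom ≫ π = π
  injective_app : ∀ U : V.left.Opens, Function.Injective (π.left.app U)
  range_app : ∀ U : V.left.Opens,
    Set.range (π.left.app U) = {a | IsInvariantSection ρ (π.left ⁻¹ᵁ U) a}

/-- `π : W ⟶ V` is a Galois covering with Galois group `𝔤`: `V = W / 𝔤`, and `𝔤` is the full group
of automorphisms of `W` over `V`. -/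
structure IsGaloisCovering (ρ : 𝔤 →* Aut W) (π : W ⟶ V) : Prop where
  isQuotientBy : IsQuotientBy ρ π
  injective : Function.Injective ρ
  surjective : ∀ α : Aut W, α.hom ≫ π = π → ∃ s : 𝔤, ρ s = α

variable {W' V' : Over (Spec (.of k))}

/-- The square of rational maps with sides `g : W ⤏ W'`, `π : W ⟶ V`, `θ : W' ⟶ V'`, `f : V ⤏ V'`
is a pullback diagram, compatible with the actions `ρ` and `τ` of `𝔤` on `W` and `W'`: there is
a dense open subset `U` of `V` such that `f` is represented by a morphism `f₀` on `U`, and `g` by a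
`𝔤`-equivariant morphism `g₀` on the dense open subset `π⁻¹ U` of `W`, which make the square with
corners `π⁻¹ U`, `W'`, `U`, `V'` cartesian. -/
def IsRationalPullback (ρ : 𝔤 →* Aut W) (τ : 𝔤 →* Aut W') (π : W ⟶ V) (θ : W' ⟶ V')
    (g : W.left ⤏ W'.left) (f : V.left ⤏ V'.left) : Prop :=
  ∃ (U : V.left.Opens) (hU : Dense (U : Set V.left))
    (hU' : Dense ((π.left ⁻¹ᵁ U : W.left.Opens) : Set W.left))
    (f₀ : U.toScheme ⟶ V'.left) (g₀ : (π.left ⁻¹ᵁ U).toScheme ⟶ W'.left),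
    Scheme.PartialMap.toRationalMap ⟨U, hU, f₀⟩ = f ∧
    Scheme.PartialMap.toRationalMap ⟨π.left ⁻¹ᵁ U, hU', g₀⟩ = g ∧
    IsPullback g₀ (π.left ∣_ U) θ.left f₀ ∧
    ∀ s : 𝔤, ∃ h : π.left ⁻¹ᵁ U ≤ (ρ s).hom.left ⁻¹ᵁ (π.left ⁻¹ᵁ U),
      (ρ s).hom.left.resLE (π.left ⁻¹ᵁ U) (π.left ⁻¹ᵁ U) h ≫ g₀ = g₀ ≫ (τ s).hom.left

end Quotient
end AlgebraicVariety

/-! A function `x` on `W` with conjugates `x_s = φ_{s⁻¹}(x)` gives the element `∑ x_s • s` of the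
group algebra. Where its determinant is invertible it is a unit, hence an equivariant morphism `g`
to `G'`. There the `x_s` are also a basis of the functions on `W` over those on `V`
(`IsNormalFamily.isBasisOver`). The coordinates of `G'` form such a family too, so with `G` the
spectrum of the invariants, `G' → G` is free on them. The comorphism of `g` carries one basis to the
other, and a commutative square of rings that does so is a pushout; hence the square is cartesian
(`IsNormalQuotient.isPullback`).

The group law descends to `G` because a quotient with a normal basis stays one after base change: `θ
⊗ θ` is then epimorphic towards affine schemes, and invariant maps factor through the quotient
(`IsNormalQuotient.exists_grpObj`).

It remains to find `x` with nonzero determinant (`exists_det_smul_ne_zero`). Choose a prime `P` of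
the functions on an affine piece of `W` lying over `0`. Since `𝔤` is abelian and the ring reduced,
the stabilizer of `P` acts faithfully on the residue field of `P`. The normal basis theorem gives a
normal element there, which lifts, up to an invariant factor, to an `x` whose conjugates by elements
outside the stabilizer vanish modulo `P`. The square of the determinant is invariant, so it comes
from a nonzero function on `V`, and `U` is where that function is invertible. -/

namespace GroupAlgebra

/-! ### Bases of ring extensions and pushouts. -/

section Basis

variable {𝔤 : Type*} [Fintype 𝔤] {R S : Type*} [CommRing R] [CommRing S]

/-- `x` is a basis of the target of the ring homomorphism `i` over its source. -/
def IsBasisOver (i : S →+* R) (x : 𝔤 → R) : Prop :=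
  Function.Bijective fun b : 𝔤 → S => ∑ s, i (b s) * x s

variable {x : 𝔤 → R} {i : S →+* R}

/-- The basis given by `IsBasisOver`. -/
noncomputable def IsBasisOver.basis [Algebra S R] (h : IsBasisOver (algebraMap S R) x) :
    Module.Basis 𝔤 S R :=
  Module.Basis.ofEquivFun (LinearEquiv.ofBijective
    (Fintype.linearCombination S x) (by
      have : ⇑(Fintype.linearCombination S x) = fun b => ∑ s, algebraMap S R (b s) * x s := by
        ext b
        simp [Fintype.linearCombination_apply, Algebra.smul_def]
      rw [this]
      exact h)).symm

lemma IsBasisOver.basis_apply [Algebra S R] (h : IsBasisOver (algebraMap S R) x) (s : 𝔤) :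
    h.basis s = x s := by
  classical
  simp [IsBasisOver.basis, Fintype.linearCombination_apply_single]

lemma _root_.Module.Basis.isBasisOver [Algebra S R] (e : Module.Basis 𝔤 S R) :
    IsBasisOver (algebraMap S R) e := by
  have : ⇑e.equivFun.symm = fun b => ∑ s, algebraMap S R (b s) * e s := by
    ext b
    simp [Module.Basis.equivFun_symm_apply, Algebra.smul_def]
  rw [IsBasisOver, ← this]
  exact e.equivFun.symm.bijective

lemma IsBasisOver.finite (h : IsBasisOver i x) : i.Finite := by
  algebraize [i]
  have h' : IsBasisOver (algebraMap S R) x := h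
  exact Module.Finite.of_basis h'.basis

end Basis

section Pushout
variable {𝔤 : Type*} [Fintype 𝔤]

lemma isBasisOver_of_isPushout {S R S' R' : Type*} [CommRing S] [CommRing R] [CommRing S']
    [CommRing R'] [Algebra S R] [Algebra S S'] [Algebra R R'] [Algebra S' R'] [Algebra S R']
    [IsScalarTower S R R'] [IsScalarTower S S' R'] {x : 𝔤 → R}
    (h : IsBasisOver (algebraMap S R) x) [H : Algebra.IsPushout S S' R R'] :
    IsBasisOver (algebraMap S' R') (algebraMap R R' ∘ x) := by
  have he : ⇑(H.out.basis h.basis) = algebraMap R R' ∘ x := by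
    ext s
    rw [IsBaseChange.basis_apply, h.basis_apply]
    rfl
  exact he ▸ (H.out.basis h.basis).isBasisOver

lemma isPushout_of_isBasisOver {S R S' R' : Type*} [CommRing S] [CommRing R] [CommRing S']
    [CommRing R'] [Algebra S R] [Algebra S S'] [Algebra R R'] [Algebra S' R'] [Algebra S R']
    [IsScalarTower S R R'] [IsScalarTower S S' R'] {x : 𝔤 → R}
    (h : IsBasisOver (algebraMap S R) x)
    (h' : IsBasisOver (algebraMap S' R') (algebraMap R R' ∘ x)) : Algebra.IsPushout S S' R R' := by
  let e := (h.basis.baseChange S').equiv h'.basis (Equiv.refl 𝔤)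
  refine ⟨IsBaseChange.of_equiv e fun a => ?_⟩
  have : (e.restrictScalars S).toLinearMap ∘ₗ TensorProduct.mk S S' R 1 =
      (IsScalarTower.toAlgHom S R R').toLinearMap := by
    refine h.basis.ext fun s => ?_
    have := (h.basis.baseChange S').equiv_apply s h'.basis (Equiv.refl 𝔤)
    rw [Module.Basis.baseChange_apply] at this
    simp only [LinearMap.comp_apply, TensorProduct.mk_apply]
    refine this.trans ?_
    rw [Equiv.refl_apply, h'.basis_apply, h.basis_apply]
    rfl
  exact congrArg (fun l => l a) this

variable {S R S' R' : CommRingCat.{u}} {i : S ⟶ R} {i' : S' ⟶ R'} {f : S ⟶ S'} {g : R ⟶ R'}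
  {x : 𝔤 → R}

lemma IsBasisOver.of_isPushout (h : IsBasisOver i.hom x) (H : IsPushout i f g i') :
    IsBasisOver i'.hom (g.hom ∘ x) := by
  algebraize [i.hom, i'.hom, f.hom, g.hom, g.hom.comp i.hom]
  have : IsScalarTower S S' R' := .of_algebraMap_eq' (congrArg CommRingCat.Hom.hom H.w)
  have := CommRingCat.isPushout_iff_isPushout.1 H.flip
  exact isBasisOver_of_isPushout (S := S) (R := R) (S' := S') (R' := R') h

lemma IsBasisOver.isPushout (h : IsBasisOver i.hom x) (h' : IsBasisOver i'.hom (g.hom ∘ x))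
    (w : i ≫ g = f ≫ i') : IsPushout i f g i' := by
  algebraize [i.hom, i'.hom, f.hom, g.hom, g.hom.comp i.hom]
  have : IsScalarTower S S' R' := .of_algebraMap_eq' (congrArg CommRingCat.Hom.hom w)
  exact (CommRingCat.isPushout_iff_isPushout.2
    (isPushout_of_isBasisOver (S := S) (R := R) (S' := S') (R' := R') h h')).flip

end Pushout

/-! ### Normal families and rings of invariants. -/

section NormalFamily

variable {𝔤 : Type*} [CommGroup 𝔤] [Fintype 𝔤] [DecidableEq 𝔤]
  {R S : Type*} [CommRing R] [CommRing S]

/-- A family `x` indexed by `𝔤` is normal for the ring endomorphisms `φ` if these translate it and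
`∑ s, x s • s` is invertible in the group algebra. -/
structure IsNormalFamily (φ : 𝔤 → R →+* R) (x : 𝔤 → R) : Prop where
  map_apply : ∀ s t, φ t (x s) = x (s * t⁻¹)
  isUnit_det : IsUnit (det x)

/-- The ring homomorphism `i` is an isomorphism onto the invariants of `φ`. -/
structure IsInvariantRing (φ : 𝔤 → R →+* R) (i : S →+* R) : Prop where
  injective : Function.Injective i
  mem_range_iff : ∀ a, a ∈ Set.range i ↔ ∀ s, φ s a = a

variable {φ : 𝔤 → R →+* R} {x : 𝔤 → R} {i : S →+* R}

lemma IsNormalFamily.eq_zero (h : IsNormalFamily φ x) {b : 𝔤 → R}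
    (hb : ∀ t, ∑ s, b s * x (s * t⁻¹) = 0) : b = 0 := by
  have hu : IsUnit (Matrix.of fun s t : 𝔤 => x (s * t⁻¹)) :=
    (Matrix.isUnit_iff_isUnit_det _).2 h.isUnit_det
  apply Matrix.vecMul_injective_of_isUnit hu
  ext t
  simpa [Matrix.vecMul, dotProduct] using hb t

lemma IsNormalFamily.eq_zero_of_invariant (h : IsNormalFamily φ x) {b : 𝔤 → R}
    (hb : ∀ s t, φ t (b s) = b s) (hsum : ∑ s, b s * x s = 0) : b = 0 := by
  refine h.eq_zero fun t => ?_
  have := congrArg (φ t) hsum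
  simpa [map_sum, hb, h.map_apply] using this

lemma IsNormalFamily.isBasisOver (h : IsNormalFamily φ x) (hi : IsInvariantRing φ i)
    (h1 : φ 1 = RingHom.id R) (hmul : ∀ s t, φ (s * t) = (φ s).comp (φ t)) :
    IsBasisOver i x := by
  have hinv (b : 𝔤 → S) (s t : 𝔤) : φ t (i (b s)) = i (b s) :=
    (hi.mem_range_iff _).1 ⟨_, rfl⟩ t
  constructor
  · intro b c hbc
    have := h.eq_zero_of_invariant (b := fun s => i (b s) - i (c s))
      (fun s t => by rw [map_sub, hinv, hinv]) (by
        simp only [sub_mul, Finset.sum_sub_distrib]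
        exact sub_eq_zero.2 hbc)
    funext s
    exact hi.injective (sub_eq_zero.1 (congrFun this s))
  · intro a
    -- The equations for all conjugates of `a` form an invertible linear system over `R`; the
    -- equation at `t = 1` is the wanted expansion.
    obtain ⟨b, hb⟩ : ∃ b : 𝔤 → R, ∀ t, ∑ s, b s * x (s * t⁻¹) = φ t a := by
      have hu : IsUnit (Matrix.of fun s t : 𝔤 => x (s * t⁻¹)) :=
        (Matrix.isUnit_iff_isUnit_det _).2 h.isUnit_det
      obtain ⟨b, hb⟩ := Matrix.vecMul_surjective_iff_isUnit.2 hu fun t => φ t a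
      exact ⟨b, fun t => by simpa [Matrix.vecMul, dotProduct] using congrFun hb t⟩
    -- Applying `φ r` to the equation at `t * r⁻¹` gives the one at `t` with `φ r (b s)` in place of
    -- `b s`; uniqueness makes the coefficients invariant.
    have hbi (r : 𝔤) : (fun s => φ r (b s) - b s) = 0 := by
      refine h.eq_zero fun t => ?_
      have h2 := congrArg (φ r) (hb (t * r⁻¹))
      rw [← RingHom.comp_apply, ← hmul, mul_comm r, inv_mul_cancel_right, ← hb t] at h2
      simp only [sub_mul, Finset.sum_sub_distrib]
      rw [← h2, map_sum, sub_eq_zero]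
      refine Finset.sum_congr rfl fun s _ => ?_
      rw [map_mul, h.map_apply]
      congr 2
      rw [mul_inv_rev, inv_inv, mul_comm r, _root_.mul_assoc, mul_inv_cancel_right]
    choose c hc using fun s => (hi.mem_range_iff (b s)).2 fun r => sub_eq_zero.1 (congrFun (hbi r) s)
    refine ⟨c, ?_⟩
    have := hb 1
    simpa [hc, h1] using this

lemma IsNormalFamily.isInvariantRing (h : IsNormalFamily φ x) (hx : IsBasisOver i x)
    (hi : ∀ s a, φ s (i a) = i a) : IsInvariantRing φ i where
  injective a b hab := congrFun (@hx.1 (fun _ => a) (fun _ => b) (by simp [hab])) 1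
  mem_range_iff a := by
    refine ⟨?_, fun ha => ?_⟩
    · rintro ⟨b, rfl⟩ s
      exact hi s b
    · obtain ⟨b, hb⟩ := hx.2 (a * ∑ s, x s)
      have := h.eq_zero_of_invariant (b := fun s => i (b s) - a)
        (fun s t => by rw [map_sub, hi, ha]) (by
          simp only [sub_mul, Finset.sum_sub_distrib, ← Finset.mul_sum]
          exact sub_eq_zero.2 hb)
      exact ⟨b 1, sub_eq_zero.1 (congrFun this 1)⟩

lemma IsNormalFamily.map {R' : Type*} [CommRing R'] (h : IsNormalFamily φ x)
    {φ' : 𝔤 → R' →+* R'} (g : R →+* R') (hg : ∀ s, (φ' s).comp g = g.comp (φ s)) :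
    IsNormalFamily φ' (g ∘ x) where
  map_apply s t := by
    have := congrArg (fun f => f (x s)) (hg t)
    simpa [h.map_apply] using this
  isUnit_det := by
    rw [← map_det]
    exact h.isUnit_det.map g

end NormalFamily

/-! ### Automorphisms over the ring of invariants. -/

section Automorphism
variable {𝔤 : Type*} [CommGroup 𝔤] [Finite 𝔤]
  {R S : Type*} [CommRing R] [CommRing S] [IsDomain R] {φ : 𝔤 → R →+* R} {i : S →+* R}

/-- Galois theory over the ring of invariants. It needs `R` to be a domain: a split covering of
degree at least 3 has more automorphisms. -/
lemma IsInvariantRing.exists_eq_of_comp_eq (hi : IsInvariantRing φ i) 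
    (hφ : Function.Injective φ) (h1 : φ 1 = RingHom.id R)
    (hmul : ∀ s t, φ (s * t) = (φ s).comp (φ t)) (α : R ≃+* R) (hα : ∀ a, α (i a) = i a) :
    ∃ s, φ s = α := by
  let _ : MulSemiringAction 𝔤 R := MulSemiringAction.compHom R
    ({ toFun := φ, map_one' := h1, map_mul' := hmul } : 𝔤 →* (R →+* R))
  algebraize [i]
  have : FaithfulSMul S R := (faithfulSMul_iff_algebraMap_injective S R).2 hi.injective
  have : IsGaloisGroup 𝔤 S R :=
    { faithful := ⟨fun {s t} h => hφ (RingHom.ext h)⟩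
      commutes := ⟨fun s a b => by
        rw [Algebra.smul_def, Algebra.smul_def, smul_mul']
        congr 1
        exact (hi.mem_range_iff _).1 ⟨a, rfl⟩ s⟩
      isInvariant := ⟨fun a ha => (hi.mem_range_iff _).2 ha⟩ }
  obtain ⟨s, hs⟩ := (IsGaloisGroup.mulEquivAlgEquiv 𝔤 S R).surjective
    (AlgEquiv.ofRingEquiv (f := α) hα)
  refine ⟨s, RingHom.ext fun a => ?_⟩
  exact congrArg (fun e => e a) hs

end Automorphism
end GroupAlgebra

namespace GroupAlgebra

/-! ### Existence of a normal element. -/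

section NormalElement

-- The polynomial `∏ (X - g • z)` has coefficients from `A` and becomes `X ^ n` modulo `P`. As `A`
-- embeds in `R ⧸ P`, it is `X ^ n` already, so `z ^ n = 0`.
open Polynomial in
lemma eq_zero_of_forall_smul_mem {G A R : Type*} [Group G] [Finite G] [CommRing A] [IsDomain A]
    [CommRing R] [IsReduced R] [Algebra A R] [MulSemiringAction G R] [Algebra.IsInvariant A R G]
    (P : Ideal R) [P.IsPrime] (hP : P.comap (algebraMap A R) = ⊥) (z : R)
    (hz : ∀ g : G, g • z ∈ P) : z = 0 := by
  have := Fintype.ofFinite G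
  obtain ⟨q, hq⟩ := Algebra.IsInvariant.charpoly_mem_lifts A R G z
  have hinj : Function.Injective ((Ideal.Quotient.mk P).comp (algebraMap A R)) := by
    rw [RingHom.injective_iff_ker_eq_bot, ← RingHom.comap_ker, Ideal.mk_ker, hP]
  have hX : q = X ^ Fintype.card G := by
    apply Polynomial.map_injective _ hinj
    rw [← Polynomial.map_map]
    have : q.map (algebraMap A R) = MulSemiringAction.charpoly G z := hq
    rw [this, MulSemiringAction.charpoly_eq, Polynomial.map_prod]
    have (g : G) : (X - C (g • z)).map (Ideal.Quotient.mk P) = X := by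
      rw [Polynomial.map_sub, Polynomial.map_X, Polynomial.map_C,
        Ideal.Quotient.eq_zero_iff_mem.2 (hz g), map_zero, sub_zero]
    simp [this]
  have hev := MulSemiringAction.eval_charpoly G z
  have : q.map (algebraMap A R) = MulSemiringAction.charpoly G z := hq
  rw [← this, hX] at hev
  have hn : z ^ Fintype.card G = 0 := by simpa using hev
  exact eq_zero_of_pow_eq_zero hn

/-- For a normal basis generator `y`, the operator `∑ w h • h` kills a basis over the fixed field,
hence is zero; independence of automorphisms over `L` gives `w = 0`. -/
lemma exists_normal_element_of_field (H L : Type*) [Group H] [Fintype H] [Field L]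
    [MulSemiringAction H L] [FaithfulSMul H L] :
    ∃ y : L, ∀ w : H → L, (∀ b : H, ∑ h, w h * h • b • y = 0) → w = 0 := by
  let K := FixedPoints.subfield H L
  let e : H ≃* Gal(L/K) := FixedPoints.toAlgAutMulEquiv H L
  let B := IsGalois.normalBasis K L
  refine ⟨B 1, fun w hw => ?_⟩
  have hli : LinearIndependent L (fun h : H => ((MulSemiringAction.toRingHom H L h : L →* L) : L → L)) :=
    (linearIndependent_monoidHom L L).comp (fun h : H => (MulSemiringAction.toRingHom H L h : L →* L))
      fun s t hst => FaithfulSMul.eq_of_smul_eq_smul fun a : L => DFunLike.congr_fun hst a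
  let l : L →ₗ[K] L := ∑ h, LinearMap.mulLeft K (w h) ∘ₗ ((e h : Gal(L/K)).toLinearMap)
  have hl (z : L) : l z = ∑ h, w h * h • z := by
    simp only [l, LinearMap.sum_apply]
    rfl
  have h0 : l = 0 := by
    refine B.ext fun σ => ?_
    obtain ⟨b, rfl⟩ := e.surjective σ
    rw [IsGalois.normalBasis_apply, hl]
    exact hw b
  have := Fintype.linearIndependent_iff.1 hli w (by
    ext z
    have := hl z
    rw [h0] at this
    simpa using this.symm)
  exact funext this

/-- After applying `m`, the matrix is block diagonal along the cosets of `H`, so a kernel vector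
restricts on each coset to one for the group `H`. -/
lemma det_ne_zero_of_stabilizer {G R L : Type*} [CommGroup G] [Fintype G] [DecidableEq G]
    [CommRing R] [MulSemiringAction G R] [Field L] (m : R →+* L) (H : Subgroup G)
    [MulSemiringAction H L] (hm : ∀ (h : H) a, m (h • a) = h • m a) (x : R)
    (hx : ∀ s ∉ H, m (s • x) = 0) [Fintype H]
    (hw : ∀ w : H → L, (∀ b : H, ∑ h, w h * h • b • m x = 0) → w = 0) :
    det (fun s : G => s⁻¹ • x) ≠ 0 := by
  classical
  intro h0
  replace h0 := congrArg m h0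
  rw [map_det, map_zero, det] at h0
  obtain ⟨w, hw0, hwM⟩ := Matrix.exists_mulVec_eq_zero_iff.2 h0
  refine hw0 (funext fun t₀ => ?_)
  have := hw (fun h => w (h * t₀)) fun b => ?_
  · rw [← one_mul t₀]
    exact congrFun this 1
  have hb := congrFun hwM (t₀ * (b : G)⁻¹)
  simp only [Matrix.mulVec, dotProduct, Matrix.of_apply, Function.comp_apply, Pi.zero_apply] at hb
  rw [← Equiv.sum_comp (Equiv.mulRight t₀)] at hb
  have key (u : G) : (t₀ * (b : G)⁻¹ * (Equiv.mulRight t₀ u)⁻¹)⁻¹ = u * b := by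
    simp [mul_comm, mul_left_comm]
  simp only [key] at hb
  rw [← Finset.sum_subset (Finset.subset_univ (Finset.univ.filter (· ∈ H)))] at hb
  · rw [Finset.sum_subtype (p := (· ∈ H)) _ (fun u => by simp)] at hb
    rw [← hb]
    refine Finset.sum_congr rfl fun h _ => ?_
    rw [mul_comm, mul_smul]
    congr 1
    rw [← hm, ← hm]
    rfl
  · intro u _ hu
    rw [hx, zero_mul]
    intro hub
    exact hu (by simpa using (H.mul_mem_cancel_right b.2).1 hub)

lemma exists_isPrime_comap_eq_bot (G : Type*) {A R : Type*} [Group G] [Finite G] [CommRing A]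
    [IsDomain A] [CommRing R] [Algebra A R] [FaithfulSMul A R] [MulSemiringAction G R]
    [Algebra.IsInvariant A R G] :
    ∃ P : Ideal R, P.IsPrime ∧ P.comap (algebraMap A R) = ⊥ := by
  have : Algebra.IsIntegral A R := Algebra.IsInvariant.isIntegral A R G
  obtain ⟨P, -, hP, hPA⟩ := Ideal.exists_ideal_over_prime_of_isIntegral (⊥ : Ideal A) (⊥ : Ideal R)
    (by
      rw [← RingHom.ker_eq_comap_bot,
        (RingHom.injective_iff_ker_eq_bot _).1 (FaithfulSMul.algebraMap_injective A R)])
  exact ⟨P, hP, hPA⟩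

open scoped Pointwise in
/-- A faithful action of a finite abelian group on a reduced ring whose ring of invariants is a
domain admits a generically normal element. -/
theorem exists_det_smul_ne_zero {G A R : Type*} [CommGroup G] [Fintype G] [DecidableEq G]
    [CommRing A] [IsDomain A] [CommRing R] [IsReduced R] [Algebra A R] [FaithfulSMul A R]
    [MulSemiringAction G R] [FaithfulSMul G R] [SMulCommClass G A R] [Algebra.IsInvariant A R G] :
    ∃ x : R, det (fun s : G => s⁻¹ • x) ≠ 0 := by
  classical
  obtain ⟨P, hP, hPA⟩ := exists_isPrime_comap_eq_bot G (A := A) (R := R)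
  have : P.LiesOver (⊥ : Ideal A) := ⟨hPA.symm⟩
  let H := MulAction.stabilizer G P
  let L := FractionRing (R ⧸ P)
  let _ : MulSemiringAction H (R ⧸ P) := MulSemiringAction.compHom (R ⧸ P)
    (Ideal.Quotient.stabilizerHom P (⊥ : Ideal A) G)
  let _ : MulSemiringAction H L := IsFractionRing.mulSemiringAction H (R ⧸ P) L
  let m : R →+* L := (algebraMap (R ⧸ P) L).comp (Ideal.Quotient.mk P)
  have hm0 (a : R) : m a = 0 ↔ a ∈ P := by
    rw [RingHom.comp_apply, FaithfulSMul.algebraMap_eq_zero_iff, Ideal.Quotient.eq_zero_iff_mem]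
  have hm (h : H) (a : R) : m (h • a) = h • m a :=
    algebraMap.coe_smul' (B := R ⧸ P) (C := L) h (Ideal.Quotient.mk P a)
  -- Elements of `H` that agree modulo `P` agree modulo all conjugates of `P`, because they commute
  -- with `G`; as `R` is reduced, they agree on `R`.
  have : FaithfulSMul H L := by
    refine ⟨fun {g h} hgh => ?_⟩
    apply Subtype.ext
    refine FaithfulSMul.eq_of_smul_eq_smul (α := R) fun a => ?_
    rw [← sub_eq_zero]
    refine eq_zero_of_forall_smul_mem (A := A) (G := G) P hPA _ fun s => ?_
    rw [← hm0, smul_sub, map_sub, sub_eq_zero, smul_smul, smul_smul, mul_comm s, mul_comm s,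
      mul_smul, mul_smul]
    exact (hm g (s • a)).trans ((hgh _).trans (hm h (s • a)).symm)
  obtain ⟨y, hy⟩ := exists_normal_element_of_field H L
  -- `q` is taken in all conjugates of `P` other than `P` itself; a prime containing their finite
  -- intersection would contain one of them.
  obtain ⟨q, hqP, hqs⟩ : ∃ q : R, q ∉ P ∧ ∀ s ∉ H, s • q ∈ P := by
    let I := Finset.inf {g : G | g • P ≠ P} (fun g => g • P)
    have h1 : ¬ I ≤ P := by
      rw [Ideal.IsPrime.inf_le' inferInstance]
      rintro ⟨g, hg1, hg2⟩
      exact (Finset.mem_filter.mp hg1).2 (smul_eq_of_smul_le hg2)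
    obtain ⟨b, hbI, hbP⟩ := SetLike.not_le_iff_exists.mp h1
    refine ⟨b, hbP, fun s hs => ?_⟩
    have hs' : s⁻¹ • P ≠ P := fun h => hs (H.inv_mem_iff.1 h)
    have := (Finset.inf_le (Finset.mem_filter.mpr ⟨Finset.mem_univ s⁻¹, hs'⟩) : I ≤ s⁻¹ • P) hbI
    simpa using (Ideal.mem_inv_pointwise_smul_iff).1 this
  obtain ⟨r, x₀, hr, hx₀⟩ : ∃ r x₀ : R, r ∉ P ∧ m r * y = m x₀ := by
    obtain ⟨a, b, hb, rfl⟩ := IsFractionRing.div_surjective (A := R ⧸ P) y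
    obtain ⟨a, rfl⟩ := Ideal.Quotient.mk_surjective a
    obtain ⟨b, rfl⟩ := Ideal.Quotient.mk_surjective b
    have hb0 : Ideal.Quotient.mk P b ≠ 0 := nonZeroDivisors.ne_zero hb
    refine ⟨b, a, fun h => hb0 (Ideal.Quotient.eq_zero_iff_mem.2 h), mul_div_cancel₀ _ ?_⟩
    rwa [Ne, hm0, ← Ideal.Quotient.eq_zero_iff_mem]
  -- The norm turns the correcting factor `q * r` into an `H`-invariant one modulo `P`, so that `m n
  -- * y` is still normal.
  let n := ∏ h : H, (h : G) • (q * r)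
  have hmn (h : H) : h • m n = m n := by
    rw [← hm, Finset.smul_prod']
    congr 1
    refine (Fintype.prod_equiv (Equiv.mulLeft h) _ _ fun b => ?_)
    simp [mul_smul, Subgroup.smul_def]
  have hn0 : m n ≠ 0 := by
    rw [Ne, hm0, Ideal.IsPrime.prod_mem_iff]
    rintro ⟨h, -, hh⟩
    have : (h : G) • P = P := h.2
    rw [← this, Ideal.smul_mem_pointwise_smul_iff] at hh
    exact (hP.mem_or_mem hh).elim hqP hr
  obtain ⟨n', hn'⟩ : q * r ∣ n := by
    simpa only [OneMemClass.coe_one, one_smul] using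
      Finset.dvd_prod_of_mem (fun h : H => (h : G) • (q * r)) (Finset.mem_univ 1)
  have hx : m (n' * q * x₀) = m n * y := by
    rw [hn', map_mul, ← hx₀, ← _root_.mul_assoc, ← map_mul]
    congr 2
    ring
  refine ⟨n' * q * x₀, det_ne_zero_of_stabilizer m H hm _ (fun s hs => ?_) fun w hw => hy w
    fun b => ?_⟩
  · rw [hm0, smul_mul', smul_mul']
    exact P.mul_mem_right _ (P.mul_mem_left _ (hqs s hs))
  · have := hw b
    simp only [hx, smul_mul', hmn, mul_left_comm (w _), ← Finset.mul_sum] at this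
    exact (mul_eq_zero.1 this).resolve_left hn0

end NormalElement
end GroupAlgebra

namespace GroupAlgebra

/-- `φ t` permutes the rows of the matrix, so it changes the determinant only by a sign. -/
lemma IsNormalFamily.map_det_sq {𝔤 R : Type*} [CommGroup 𝔤] [Fintype 𝔤] [DecidableEq 𝔤] [CommRing R]
    {φ : 𝔤 → R →+* R} {x : 𝔤 → R} (h : ∀ s t, φ t (x s) = x (s * t⁻¹)) (t : 𝔤) :
    φ t (det x ^ 2) = det x ^ 2 := by
  have : φ t (det x) = Equiv.Perm.sign (Equiv.mulRight t⁻¹) * det x := by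
    rw [map_det, det, det, ← Matrix.det_permute]
    congr 1
    ext r s
    simp [h, mul_right_comm]
  rw [map_pow, this, mul_pow]
  norm_cast
  simp

/-! ### Affine quotients with a normal basis. -/

section NormalQuotient

lemma _root_.RingHom.exists_comp_eq_of_range_subset {S R T : Type*} [CommRing S] [CommRing R]
    [CommRing T] (i : S →+* R) (hi : Function.Injective i) (f : T →+* R)
    (hf : ∀ t, f t ∈ Set.range i) : ∃ g : T →+* S, i.comp g = f := by
  let e : S ≃+* i.range := RingEquiv.ofBijective i.rangeRestrict
    ⟨fun a b h => hi (congrArg Subtype.val h), i.rangeRestrict_surjective⟩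
  refine ⟨e.symm.toRingHom.comp (f.codRestrict i.range hf), RingHom.ext fun t => ?_⟩
  exact congrArg Subtype.val (e.apply_symm_apply (f.codRestrict i.range hf t))

lemma _root_.AlgebraicGeometry.Scheme.exists_appTop_eq {Y Z : Scheme.{u}} [IsAffine Z]
    (g : Γ(Z, ⊤) ⟶ Γ(Y, ⊤)) : ∃ h : Y ⟶ Z, h.appTop = g := by
  obtain ⟨h, e⟩ : ∃ h : Y ⟶ Z, Y.toSpecΓ ≫ Spec.map h.appTop = Y.toSpecΓ ≫ Spec.map g := by
    refine ⟨Y.toSpecΓ ≫ Spec.map g ≫ Z.isoSpec.inv, ?_⟩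
    rw [← Scheme.toSpecΓ_naturality, ← Z.isoSpec_hom]
    simp only [Category.assoc, Iso.inv_hom_id, Category.comp_id]
  refine ⟨h, ?_⟩
  have e' := congrArg Scheme.Hom.appTop e
  rwa [Scheme.Hom.comp_appTop, Scheme.Hom.comp_appTop, Scheme.toSpecΓ_appTop,
    Scheme.ΓSpecIso_naturality, Scheme.ΓSpecIso_naturality, cancel_epi] at e'

lemma _root_.AlgebraicGeometry.isPullback_of_isPushout_appTop {X Y X' Y' : Scheme.{u}} [IsAffine X]
    [IsAffine Y] [IsAffine X'] [IsAffine Y'] {a : X' ⟶ X} {p' : X' ⟶ Y'} {p : X ⟶ Y} {b : Y' ⟶ Y}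
    (h : IsPushout p.appTop b.appTop a.appTop p'.appTop) : IsPullback a p' p b := by
  refine (isPullback_SpecMap_of_isPushout _ _ _ _ h).of_iso X'.isoSpec.symm X.isoSpec.symm
    Y'.isoSpec.symm Y.isoSpec.symm ?_ ?_ ?_ ?_ <;> simp [Scheme.isoSpec_inv_naturality]

variable {𝔤 : Type*} [CommGroup 𝔤] [Fintype 𝔤] [DecidableEq 𝔤]

/-- `p : X ⟶ Y` is an invariant morphism of affine schemes and the family `x` of functions on `X`
is translated by the endomorphisms `σ`, corresponds to a unit of the group algebra, and is a basis
of functions on `X` over functions on `Y`. -/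
structure IsNormalQuotient {X Y : Scheme.{u}} (σ : 𝔤 → (X ⟶ X)) (p : X ⟶ Y) (x : 𝔤 → Γ(X, ⊤)) :
    Prop where
  isAffine_source : IsAffine X
  isAffine_target : IsAffine Y
  comp_eq : ∀ s, σ s ≫ p = p
  isNormalFamily : IsNormalFamily (fun s => (σ s).appTop.hom) x
  isBasisOver : IsBasisOver p.appTop.hom x

namespace IsNormalQuotient

variable {X Y X' Y' Z : Scheme.{u}} {σ : 𝔤 → (X ⟶ X)} {p : X ⟶ Y} {x : 𝔤 → Γ(X, ⊤)}

lemma isInvariantRing (h : IsNormalQuotient σ p x) :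
    IsInvariantRing (fun s => (σ s).appTop.hom) p.appTop.hom :=
  h.isNormalFamily.isInvariantRing h.isBasisOver fun s a => by
    rw [← CommRingCat.comp_apply, ← Scheme.Hom.comp_appTop, h.comp_eq]

lemma hom_ext (h : IsNormalQuotient σ p x) [IsAffine Z] {f g : Y ⟶ Z} (hfg : p ≫ f = p ≫ g) :
    f = g := by
  apply ext_of_isAffine
  ext a
  apply h.isInvariantRing.injective
  rw [← CommRingCat.comp_apply, ← CommRingCat.comp_apply, ← Scheme.Hom.comp_appTop, hfg,
    Scheme.Hom.comp_appTop]

lemma exists_desc (h : IsNormalQuotient σ p x) [IsAffine Z] (f : X ⟶ Z) (hf : ∀ s, σ s ≫ f = f) :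
    ∃ g : Y ⟶ Z, p ≫ g = f := by
  obtain ⟨g, hg⟩ := RingHom.exists_comp_eq_of_range_subset p.appTop.hom
    h.isInvariantRing.injective f.appTop.hom fun t => (h.isInvariantRing.mem_range_iff _).2 fun s => by
      rw [← CommRingCat.comp_apply, ← Scheme.Hom.comp_appTop, hf]
  obtain ⟨k, hk⟩ := Scheme.exists_appTop_eq (CommRingCat.ofHom g)
  refine ⟨k, ext_of_isAffine ?_⟩
  rw [Scheme.Hom.comp_appTop, hk]
  ext1
  exact hg

/-- Taking invariants need not commute with base change, but a basis and a unit determinant survive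
it and determine the invariants again. -/
lemma of_isPullback (h : IsNormalQuotient σ p x) [IsAffine Y'] {a : X' ⟶ X} {p' : X' ⟶ Y'}
    {b : Y' ⟶ Y} (H : IsPullback a p' p b) {σ' : 𝔤 → (X' ⟶ X')} (hp : ∀ s, σ' s ≫ p' = p')
    (ha : ∀ s, σ' s ≫ a = a ≫ σ s) : IsNormalQuotient σ' p' (a.appTop.hom ∘ x) := by
  have := h.isAffine_source
  have := h.isAffine_target
  exact
  { isAffine_source := .of_isPullback H
    isAffine_target := inferInstance
    comp_eq := hp
    isNormalFamily := h.isNormalFamily.map _ fun s => by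
      rw [← CommRingCat.hom_comp, ← CommRingCat.hom_comp, ← Scheme.Hom.comp_appTop, ha,
        Scheme.Hom.comp_appTop]
    isBasisOver := h.isBasisOver.of_isPushout (isPushout_appTop_of_isPullback H) }

lemma isPullback (h : IsNormalQuotient σ p x) {a : X' ⟶ X} {p' : X' ⟶ Y'}
    {b : Y' ⟶ Y} {σ' : 𝔤 → (X' ⟶ X')} (h' : IsNormalQuotient σ' p' (a.appTop.hom ∘ x))
    (w : a ≫ p = p' ≫ b) : IsPullback a p' p b := by
  have := h.isAffine_source
  have := h.isAffine_target
  have := h'.isAffine_source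
  have := h'.isAffine_target
  refine isPullback_of_isPushout_appTop (h.isBasisOver.isPushout h'.isBasisOver ?_)
  rw [← Scheme.Hom.comp_appTop, w, Scheme.Hom.comp_appTop]

lemma isFinite (h : IsNormalQuotient σ p x) : IsFinite p := by
  have := h.isAffine_source
  have := h.isAffine_target
  have : IsFinite (Spec.map p.appTop) := (IsFinite.SpecMap_iff _).2 h.isBasisOver.finite
  have e : p = X.isoSpec.hom ≫ Spec.map p.appTop ≫ Y.isoSpec.inv := by
    rw [← Category.assoc, Iso.eq_comp_inv, Scheme.isoSpec_hom_naturality]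
  rw [e]
  infer_instance

lemma surjective (h : IsNormalQuotient σ p x) : Surjective p := by
  have := h.isAffine_source
  have := h.isAffine_target
  rw [MorphismProperty.arrow_mk_iso_iff @Surjective (arrowIsoSpecΓOfIsAffine p), surjective_iff]
  exact h.isBasisOver.finite.to_isIntegral.comap_surjective h.isInvariantRing.injective

end IsNormalQuotient
end NormalQuotient
end GroupAlgebra

namespace GroupAlgebra

/-! ### Descent of the group structure. -/

section Descent
universe v w
variable {C : Type w} [Category.{v} C] [CartesianMonoidalCategory C] {G' G : C} [GrpObj G']

/-- A group structure descends along `θ` if the structure morphisms do and the powers of `θ` are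
epimorphic with respect to morphisms to the target. -/
@[reducible] def grpObjOfDescent (θ : G' ⟶ G) (m : G ⊗ G ⟶ G) (v : G ⟶ G)
    (hm : (θ ⊗ₘ θ) ≫ m = μ ≫ θ) (hv : θ ≫ v = ι ≫ θ)
    (h1 : ∀ f g : G ⟶ G, θ ≫ f = θ ≫ g → f = g)
    (h3 : ∀ f g : (G ⊗ G) ⊗ G ⟶ G, ((θ ⊗ₘ θ) ⊗ₘ θ) ≫ f = ((θ ⊗ₘ θ) ⊗ₘ θ) ≫ g → f = g) :
    GrpObj G where
  one := η[G'] ≫ θ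
  mul := m
  inv := v
  one_mul := by
    rw [← cancel_epi (λ_ G).inv]
    apply h1
    have h : 𝟙_ C ◁ θ ≫ (η[G'] ≫ θ) ▷ G = η[G'] ▷ G' ≫ (θ ⊗ₘ θ) := by
      simp [← id_tensorHom, ← tensorHom_id]
    rw [← Category.assoc, leftUnitor_inv_naturality, Category.assoc, reassoc_of% h, hm,
      MonObj.one_mul_assoc]
    simp
  mul_one := by
    rw [← cancel_epi (ρ_ G).inv]
    apply h1
    have h : θ ▷ 𝟙_ C ≫ G ◁ (η[G'] ≫ θ) = G' ◁ η[G'] ≫ (θ ⊗ₘ θ) := by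
      simp [← id_tensorHom, ← tensorHom_id]
    rw [← Category.assoc, rightUnitor_inv_naturality, Category.assoc, reassoc_of% h, hm,
      MonObj.mul_one_assoc]
    simp
  mul_assoc := by
    apply h3
    have h : ((θ ⊗ₘ θ) ⊗ₘ θ) ≫ m ▷ G = μ ▷ G' ≫ (θ ⊗ₘ θ) := by
      rw [← tensorHom_id, MonoidalCategory.tensorHom_comp_tensorHom, hm, Category.comp_id]
      simp [← tensorHom_id]
    have h' : (θ ⊗ₘ θ ⊗ₘ θ) ≫ G ◁ m = G' ◁ μ ≫ (θ ⊗ₘ θ) := by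
      simp [← id_tensorHom, hm]
    rw [reassoc_of% h, associator_naturality_assoc, reassoc_of% h', hm, MonObj.mul_assoc_assoc]
  left_inv := by
    apply h1
    have h : θ ≫ lift v (𝟙 G) = lift ι (𝟙 G') ≫ (θ ⊗ₘ θ) := by simp [hv]
    rw [reassoc_of% h, hm, GrpObj.left_inv_assoc]
    simp
  right_inv := by
    apply h1
    have h : θ ≫ lift (𝟙 G) v = lift (𝟙 G') ι ≫ (θ ⊗ₘ θ) := by simp [hv]
    rw [reassoc_of% h, hm, GrpObj.right_inv_assoc]
    simp

end Descent

section OverDescent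

variable {𝔤 : Type*} [CommGroup 𝔤] [Fintype 𝔤] [DecidableEq 𝔤] {S : Scheme.{u}}

instance [IsAffine S] (X Y : Over S) [IsAffine X.left] [IsAffine Y.left] : IsAffine (X ⊗ Y).left :=
  inferInstanceAs (IsAffine (Limits.pullback X.hom Y.hom))

/-- Exhibits whiskering as a base change, so that normal quotients are stable under it. -/
lemma isPullback_whiskerRight {X Y : Over S} (q : X ⟶ Y) (Z : Over S) :
    IsPullback (fst X Z).left (q ▷ Z).left q.left (fst Y Z).left := by
  have : IsPullback (fst X Z) (q ▷ Z) q (fst Y Z) := by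
    refine ⟨⟨by simp⟩, ⟨Limits.PullbackCone.IsLimit.mk _ (fun s => lift s.fst (s.snd ≫ snd _ _))
      (fun s => by simp) (fun s => ?_) (fun s m h₁ h₂ => ?_)⟩⟩
    · ext1
      · simpa using s.condition
      · simp
    · ext1
      · simpa using h₁
      · simp [← h₂]
  exact this.map (Over.forget S)

lemma isPullback_whiskerLeft {X Y : Over S} (q : X ⟶ Y) (Z : Over S) :
    IsPullback (snd Z X).left (Z ◁ q).left q.left (snd Z Y).left := by
  have : IsPullback (snd Z X) (Z ◁ q) q (snd Z Y) := by
    refine ⟨⟨by simp⟩, ⟨Limits.PullbackCone.IsLimit.mk _ (fun s => lift (s.snd ≫ fst _ _) s.fst)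
      (fun s => by simp) (fun s => ?_) (fun s m h₁ h₂ => ?_)⟩⟩
    · ext1
      · simp
      · simpa using s.condition
    · ext1
      · simp [← h₂]
      · simpa using h₁
  exact this.map (Over.forget S)

namespace IsNormalQuotient

variable {X Y : Over S} {a : 𝔤 → (X ⟶ X)} {q : X ⟶ Y} {x : 𝔤 → Γ(X.left, ⊤)}

lemma over_hom_ext (h : IsNormalQuotient (fun s => (a s).left) q.left x) {Z : Over S}
    [IsAffine Z.left] {f g : Y ⟶ Z} (hfg : q ≫ f = q ≫ g) : f = g := by
  ext1
  exact h.hom_ext (congrArg CommaMorphism.left hfg)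

lemma over_exists_desc [IsAffine S] (h : IsNormalQuotient (fun s => (a s).left) q.left x)
    {Z : Over S} [IsAffine Z.left] (f : X ⟶ Z) (hf : ∀ s, a s ≫ f = f) :
    ∃ g : Y ⟶ Z, q ≫ g = f := by
  obtain ⟨g, hg⟩ := h.exists_desc f.left fun s => congrArg CommaMorphism.left (hf s)
  refine ⟨Over.homMk g (h.hom_ext ?_), Over.OverMorphism.ext hg⟩
  rw [reassoc_of% hg]
  simp

lemma whiskerRight [IsAffine S] (h : IsNormalQuotient (fun s => (a s).left) q.left x) (Z : Over S)
    [IsAffine Z.left] :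
    IsNormalQuotient (fun s => (a s ▷ Z).left) (q ▷ Z).left ((fst X Z).left.appTop.hom ∘ x) := by
  have := h.isAffine_target
  refine h.of_isPullback (isPullback_whiskerRight q Z) (fun s => ?_) fun s => ?_
  · have : a s ≫ q = q := Over.OverMorphism.ext (h.comp_eq s)
    rw [← Over.comp_left, ← comp_whiskerRight, this]
  · rw [← Over.comp_left, ← Over.comp_left, whiskerRight_fst]

lemma whiskerLeft [IsAffine S] (h : IsNormalQuotient (fun s => (a s).left) q.left x) (Z : Over S)
    [IsAffine Z.left] :
    IsNormalQuotient (fun s => (Z ◁ a s).left) (Z ◁ q).left ((snd Z X).left.appTop.hom ∘ x) := by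
  have := h.isAffine_target
  refine h.of_isPullback (isPullback_whiskerLeft q Z) (fun s => ?_) fun s => ?_
  · have : a s ≫ q = q := Over.OverMorphism.ext (h.comp_eq s)
    rw [← Over.comp_left, ← whiskerLeft_comp, this]
  · rw [← Over.comp_left, ← Over.comp_left, whiskerLeft_snd]

end IsNormalQuotient

/-- The quotient of an affine commutative group scheme by a group of translations is a
commutative group scheme. -/
theorem IsNormalQuotient.exists_grpObj [IsAffine S] {G' G : Over S} [GrpObj G'] [IsCommMonObj G']
    {a : 𝔤 → (G' ⟶ G')} {θ : G' ⟶ G} {x : 𝔤 → Γ(G'.left, ⊤)}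
    (h : IsNormalQuotient (fun s => (a s).left) θ.left x)
    (hl : ∀ s, a s ▷ G' ≫ μ = μ ≫ a s) (hr : ∀ s, G' ◁ a s ≫ μ = μ ≫ a s)
    (hv : ∀ s, a s ≫ ι ≫ θ = ι ≫ θ) :
    ∃ (_ : GrpObj G), IsMonHom θ ∧ IsCommMonObj G := by
  have := h.isAffine_source
  have := h.isAffine_target
  have hθ (s : 𝔤) : a s ≫ θ = θ := Over.OverMorphism.ext (h.comp_eq s)
  obtain ⟨v, hv⟩ := h.over_exists_desc (ι ≫ θ) hv
  -- Multiplication descends one factor at a time, through `G ⊗ G'`.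
  obtain ⟨m₁, hm₁⟩ := (h.whiskerRight G').over_exists_desc (μ ≫ θ) fun s => by
    rw [reassoc_of% hl s, hθ]
  obtain ⟨m, hm⟩ := (h.whiskerLeft G).over_exists_desc m₁ fun s => by
    apply (h.whiskerRight G').over_hom_ext
    rw [← whisker_exchange_assoc, hm₁, reassoc_of% hr s, hθ]
  have hm' : (θ ⊗ₘ θ) ≫ m = μ ≫ θ := by rw [MonoidalCategory.tensorHom_def, Category.assoc, hm, hm₁]
  have h2 {X : Over S} [IsAffine X.left] (f g : G ⊗ G ⟶ X) (e : (θ ⊗ₘ θ) ≫ f = (θ ⊗ₘ θ) ≫ g) :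
      f = g := by
    rw [MonoidalCategory.tensorHom_def, Category.assoc, Category.assoc] at e
    exact (h.whiskerLeft G).over_hom_ext ((h.whiskerRight G').over_hom_ext e)
  have h3 (f g : (G ⊗ G) ⊗ G ⟶ G) (e : ((θ ⊗ₘ θ) ⊗ₘ θ) ≫ f = ((θ ⊗ₘ θ) ⊗ₘ θ) ≫ g) : f = g := by
    rw [MonoidalCategory.tensorHom_def, MonoidalCategory.tensorHom_def, comp_whiskerRight,
      Category.assoc, Category.assoc, Category.assoc, Category.assoc] at e
    exact (h.whiskerLeft (G ⊗ G)).over_hom_ext (((h.whiskerLeft G).whiskerRight G').over_hom_ext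
      (((h.whiskerRight G').whiskerRight G').over_hom_ext e))
  let _ : GrpObj G := grpObjOfDescent θ m v hm' hv (fun f g => h.over_hom_ext) h3
  refine ⟨inferInstance, ⟨rfl, hm'.symm⟩, ⟨h2 _ _ ?_⟩⟩
  rw [BraidedCategory.braiding_naturality_assoc]
  change _ ≫ (θ ⊗ₘ θ) ≫ m = (θ ⊗ₘ θ) ≫ m
  rw [hm', IsCommMonObj.mul_comm_assoc]

end OverDescent
end GroupAlgebra

namespace GroupAlgebra

/-! ### Sections over arbitrary open subsets. -/

section Restrict

variable {X Y : Scheme.{u}} {p : X ⟶ Y} {a : X ⟶ X}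

lemma preimage_le_of_comp_eq (h : a ≫ p = p) (U : Y.Opens) : p ⁻¹ᵁ U ≤ a ⁻¹ᵁ (p ⁻¹ᵁ U) := by
  rw [← Scheme.Hom.comp_preimage, h]

/-- The restriction of an endomorphism over `Y` to the inverse image of an open subset of `Y`. -/
noncomputable def restrictEnd (h : a ≫ p = p) (U : Y.Opens) :
    (p ⁻¹ᵁ U).toScheme ⟶ (p ⁻¹ᵁ U).toScheme :=
  a.resLE (p ⁻¹ᵁ U) (p ⁻¹ᵁ U) (preimage_le_of_comp_eq h U)

lemma restrictEnd_ι (h : a ≫ p = p) (U : Y.Opens) :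
    restrictEnd h U ≫ (p ⁻¹ᵁ U).ι = (p ⁻¹ᵁ U).ι ≫ a :=
  Scheme.Hom.resLE_comp_ι _ _

lemma restrictEnd_ι_assoc (h : a ≫ p = p) (U : Y.Opens) {Z : Scheme.{u}} (b : X ⟶ Z) :
    restrictEnd h U ≫ (p ⁻¹ᵁ U).ι ≫ b = (p ⁻¹ᵁ U).ι ≫ a ≫ b := by
  rw [← Category.assoc, restrictEnd_ι, Category.assoc]

lemma restrictEnd_comp (h : a ≫ p = p) (U : Y.Opens) : restrictEnd h U ≫ p ∣_ U = p ∣_ U := by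
  rw [← cancel_mono U.ι, Category.assoc, morphismRestrict_ι, restrictEnd_ι_assoc, h]

lemma isInvariantRing_restrictEnd_iff {𝔤 : Type*} {a : 𝔤 → (X ⟶ X)} (h : ∀ s, a s ≫ p = p)
    (U : Y.Opens) :
    IsInvariantRing (fun s => (restrictEnd (h s) U).appTop.hom) (p ∣_ U).appTop.hom ↔
      Function.Injective (p.app U) ∧ ∀ b, b ∈ Set.range (p.app U) ↔
        ∀ s, (a s).appLE _ _ (preimage_le_of_comp_eq (h s) U) b = b := by
  let e := U.topIso.commRingCatIsoToRingEquiv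
  let e' := (p ⁻¹ᵁ U).topIso.commRingCatIsoToRingEquiv
  have h₁ (c) : e' ((p ∣_ U).appTop c) = p.app U (e c) := by
    have : (p ∣_ U).appTop = _ :=
      (congrArg Scheme.Hom.appTop (p.resLE_eq_morphismRestrict (U := U))).symm.trans
        (Scheme.Hom.resLE_app_top _ _)
    rw [this, ← Scheme.Hom.app_eq_appLE]
    exact (p ⁻¹ᵁ U).topIso.commRingCatIsoToRingEquiv.apply_symm_apply _
  have h₂ (s : 𝔤) (c) : e' ((restrictEnd (h s) U).appTop c) =
      (a s).appLE _ _ (preimage_le_of_comp_eq (h s) U) (e' c) := by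
    have : (restrictEnd (h s) U).appTop = _ := Scheme.Hom.resLE_app_top _ _
    rw [this]
    exact (p ⁻¹ᵁ U).topIso.commRingCatIsoToRingEquiv.apply_symm_apply _
  have hr (c) : c ∈ Set.range (p ∣_ U).appTop.hom ↔ e' c ∈ Set.range (p.app U) := by
    constructor
    · rintro ⟨b, rfl⟩
      exact ⟨e b, (h₁ b).symm⟩
    · rintro ⟨b, hb⟩
      refine ⟨e.symm b, e'.injective ?_⟩
      rw [← hb]
      exact (h₁ _).trans (by rw [e.apply_symm_apply])
  have hi : (∀ b, b ∈ Set.range (p.app U) ↔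
        ∀ s, (a s).appLE _ _ (preimage_le_of_comp_eq (h s) U) b = b) ↔
      ∀ c, c ∈ Set.range (p ∣_ U).appTop.hom ↔ ∀ s, (restrictEnd (h s) U).appTop.hom c = c := by
    rw [e'.surjective.forall]
    refine forall_congr' fun c => ?_
    rw [hr]
    refine iff_congr Iff.rfl (forall_congr' fun s => ?_)
    rw [← e'.injective.eq_iff, ← h₂]
  have hj : Function.Injective (p.app U) ↔ Function.Injective (p ∣_ U).appTop.hom := by
    have : e' ∘ (p ∣_ U).appTop.hom = p.app U ∘ e := funext h₁
    rw [← EquivLike.injective_comp e, ← this, EquivLike.comp_injective]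
  rw [hi, hj]
  exact ⟨fun h => ⟨h.1, h.2⟩, fun h => ⟨h.1, h.2⟩⟩

variable {𝔤 : Type*} [CommGroup 𝔤] [Fintype 𝔤] [DecidableEq 𝔤] {σ : 𝔤 → (X ⟶ X)}
  {x : 𝔤 → Γ(X, ⊤)}

lemma IsNormalQuotient.restrict (h : IsNormalQuotient σ p x) {U : Y.Opens} (hU : IsAffineOpen U) :
    IsNormalQuotient (fun s => restrictEnd (h.comp_eq s) U) (p ∣_ U)
      ((p ⁻¹ᵁ U).ι.appTop.hom ∘ x) :=
  have : IsAffine U := hU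
  h.of_isPullback (isPullback_morphismRestrict p U).flip (fun _ => restrictEnd_comp _ _)
    fun _ => restrictEnd_ι _ _

lemma iSup_affineOpens_le (U : Y.Opens) :
    U ≤ ⨆ V : {V : Y.affineOpens // (V : Y.Opens) ≤ U}, (V.1 : Y.Opens) := by
  intro y hy
  obtain ⟨_, ⟨V, hV, rfl⟩, hyV, hVU⟩ := Y.isBasis_affineOpens.exists_subset_of_mem_open hy U.2
  exact TopologicalSpace.Opens.mem_iSup.2 ⟨⟨⟨V, hV⟩, hVU⟩, hyV⟩

lemma app_map_apply (p : X ⟶ Y) {U V : Y.Opens} (hVU : V ≤ U) (c : Γ(Y, U)) :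
    p.app V (Y.presheaf.map (homOfLE hVU).op c) =
      X.presheaf.map (homOfLE (p.preimage_mono hVU)).op (p.app U c) := by
  rw [← CommRingCat.comp_apply, p.naturality]
  rfl

lemma IsNormalQuotient.injective_app (h : IsNormalQuotient σ p x) (U : Y.Opens) :
    Function.Injective (p.app U) := by
  intro b c hbc
  refine Y.sheaf.eq_of_locally_eq' (fun V : {V : Y.affineOpens // (V : Y.Opens) ≤ U} => V.1.1) U
    (fun V => homOfLE V.2) (iSup_affineOpens_le U) _ _ fun V => ?_
  apply ((isInvariantRing_restrictEnd_iff h.comp_eq _).1 (h.restrict V.1.2).isInvariantRing).1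
  exact (app_map_apply p V.2 b).trans ((congrArg _ hbc).trans (app_map_apply p V.2 c).symm)

/-- On affine opens the restricted quotient is again normal; the local descents glue by injectivity.
-/
lemma IsNormalQuotient.mem_range_app_iff (h : IsNormalQuotient σ p x) (U : Y.Opens)
    (b : Γ(X, p ⁻¹ᵁ U)) : b ∈ Set.range (p.app U) ↔
        ∀ s, (σ s).appLE _ _ (preimage_le_of_comp_eq (h.comp_eq s) U) b = b := by
  constructor
  · rintro ⟨c, rfl⟩ s
    have key (q : X ⟶ Y) (hq : q = p) (e) : q.appLE U (p ⁻¹ᵁ U) e = p.app U := by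
      subst hq
      exact q.app_eq_appLE.symm
    have hs := Scheme.Hom.comp_appLE (σ s) p U (p ⁻¹ᵁ U) (by rw [h.comp_eq])
    rw [key _ (h.comp_eq s)] at hs
    exact congrArg (fun f => f.hom c) hs.symm
  · intro hb
    have hV (V : {V : Y.affineOpens // (V : Y.Opens) ≤ U}) : ∃ c : Γ(Y, V.1.1),
        p.app V.1.1 c = X.presheaf.map (homOfLE (p.preimage_mono V.2)).op b := by
      refine (((isInvariantRing_restrictEnd_iff h.comp_eq _).1
        (h.restrict V.1.2).isInvariantRing).2 _).2 fun s => ?_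
      rw [← CommRingCat.comp_apply, Scheme.Hom.map_appLE]
      conv_rhs => rw [← hb s]
      rw [← CommRingCat.comp_apply, Scheme.Hom.appLE_map]
    choose c hc using hV
    obtain ⟨d, hd, -⟩ := Y.sheaf.existsUnique_gluing'
      (fun V : {V : Y.affineOpens // (V : Y.Opens) ≤ U} => V.1.1) U
      (fun V => homOfLE V.2) (iSup_affineOpens_le U) c fun V V' => by
        apply h.injective_app
        refine (app_map_apply p inf_le_left _).trans (Eq.trans ?_
          (app_map_apply p inf_le_right _).symm)
        rw [hc, hc, ← CommRingCat.comp_apply, ← CommRingCat.comp_apply, ← Functor.map_comp,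
          ← Functor.map_comp]
        rfl
    refine ⟨d, X.sheaf.eq_of_locally_eq'
      (fun V : {V : Y.affineOpens // (V : Y.Opens) ≤ U} => p ⁻¹ᵁ V.1.1) (p ⁻¹ᵁ U)
      (fun V => homOfLE (p.preimage_mono V.2)) ?_ _ _ fun V => ?_⟩
    · rw [← Scheme.Hom.preimage_iSup]
      exact p.preimage_mono (iSup_affineOpens_le U)
    · refine (app_map_apply p V.2 d).symm.trans (Eq.trans ?_ (hc V))
      exact congrArg _ (hd V)

end Restrict
end GroupAlgebra

/-! ### Spectrum of invariants; translations of the unit group. -/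

namespace GroupAlgebra

lemma IsNormalQuotient.of_isInvariantRing {𝔤 : Type*} [CommGroup 𝔤] [Fintype 𝔤] [DecidableEq 𝔤]
    {X Y : Scheme.{u}} [IsAffine X] [IsAffine Y] {σ : 𝔤 → (X ⟶ X)} {p : X ⟶ Y} {x : 𝔤 → Γ(X, ⊤)}
    (h1 : σ 1 = 𝟙 X) (hmul : ∀ s t, σ (s * t) = σ s ≫ σ t)
    (hi : IsInvariantRing (fun s => (σ s).appTop.hom) p.appTop.hom)
    (hx : IsNormalFamily (fun s => (σ s).appTop.hom) x) : IsNormalQuotient σ p x where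
  isAffine_source := inferInstance
  isAffine_target := inferInstance
  comp_eq s := by
    apply ext_of_isAffine
    ext a
    rw [Scheme.Hom.comp_appTop, CommRingCat.comp_apply]
    exact (hi.mem_range_iff _).1 ⟨a, rfl⟩ s
  isNormalFamily := hx
  isBasisOver := hx.isBasisOver hi (by simp [h1]) fun s t => by
    rw [hmul, Scheme.Hom.comp_appTop, CommRingCat.hom_comp]

lemma exists_isNormalQuotient {𝔤 : Type*} [CommGroup 𝔤] [Fintype 𝔤] [DecidableEq 𝔤]
    {X : Scheme.{u}} [IsAffine X] {σ : 𝔤 → (X ⟶ X)} {x : 𝔤 → Γ(X, ⊤)}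
    (h1 : σ 1 = 𝟙 X) (hmul : ∀ s t, σ (s * t) = σ s ≫ σ t)
    (hx : IsNormalFamily (fun s => (σ s).appTop.hom) x) :
    ∃ (Y : Scheme.{u}) (p : X ⟶ Y), IsNormalQuotient σ p x := by
  let B : Subring Γ(X, ⊤) := ⨅ s, RingHom.eqLocus (σ s).appTop.hom (RingHom.id _)
  let Y := Spec (.of B)
  obtain ⟨p, hp⟩ := Scheme.exists_appTop_eq (Z := Y) (Y := X)
    ((Scheme.ΓSpecIso (.of B)).hom ≫ CommRingCat.ofHom B.subtype)
  let e := (Scheme.ΓSpecIso (.of B)).commRingCatIsoToRingEquiv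
  have hp' (a) : p.appTop a = (e a).val := by rw [hp]; rfl
  refine ⟨Y, p, .of_isInvariantRing h1 hmul ⟨fun a b hab => ?_, fun a => ?_⟩ hx⟩
  · apply e.injective
    apply Subtype.ext
    rw [← hp', ← hp']
    exact hab
  · have hB : a ∈ B ↔ ∀ s, (σ s).appTop a = a := by
      simp only [B, Subring.mem_iInf]
      rfl
    refine Iff.trans ?_ hB
    constructor
    · rintro ⟨b, rfl⟩
      rw [hp']
      exact (e b).2
    · intro ha
      refine ⟨e.symm ⟨a, ha⟩, (hp' _).trans ?_⟩
      rw [e.apply_symm_apply]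

section UnitGroup

variable (S : Scheme.{u}) (𝔤 : Type u) [CommGroup 𝔤] [Fintype 𝔤] [DecidableEq 𝔤]

instance [IsAffine S] : IsAffine (unitGroup S 𝔤).left :=
  (isAffineOpen_top 𝔸(𝔤; S)).basicOpen _

instance [IsIntegral S] : IsIntegral (unitGroup S 𝔤).left := by
  have : Nonempty (unitGroup S 𝔤).left := 
    ⟨(η[unitGroup S 𝔤]).left (Nonempty.some (inferInstanceAs (Nonempty S)))⟩
  have : IsIntegral 𝔸(𝔤; S) := inferInstance
  exact isIntegral_of_isOpenImmersion (incl S 𝔤)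

lemma comp_translation {T : Over S} (f : T ⟶ unitGroup S 𝔤) (s : 𝔤) :
    f ≫ (translation S 𝔤 s).hom = f * (toUnit T ≫ point S 𝔤 s) := by
  have : (translation S 𝔤 s).hom = 𝟙 (unitGroup S 𝔤) * toUnit _ ≫ point S 𝔤 s := rfl
  rw [this, MonObj.comp_mul, Category.comp_id, ← Category.assoc,
    toUnit_unique (_ ≫ _) (toUnit T)]

/-- Translation multiplies by the basis element `s`, which shifts coefficients. -/
lemma coords_comp_translation {T : Over S} (f : T ⟶ unitGroup S 𝔤) (s t : 𝔤) :
    coords (f ≫ (translation S 𝔤 s).hom) t = coords f (t * s⁻¹) := by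
  have hs : (pointsEquiv (toUnit T ≫ point S 𝔤 s)).val = MonoidAlgebra.single s 1 := by
    apply MonoidAlgebra.ext
    ext r
    rw [coeff_pointsEquiv, coords_comp, ← coeff_pointsEquiv]
    have : pointsEquiv (point S 𝔤 s) = Units.map (MonoidAlgebra.of Γ((𝟙_ (Over S)).left, ⊤) 𝔤)
      (toUnits s) := pointsEquiv.apply_symm_apply _
    rw [this]
    change (toUnit T).left.appTop ((MonoidAlgebra.single s 1).coeff r) = _
    by_cases h : s = r
    · subst h; simp
    · simp [h]
  rw [comp_translation, ← coeff_pointsEquiv, map_mul, Units.val_mul, hs,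
    MonoidAlgebra.coeff_mul_single_eq_coeff_mul (m₂ := t * s⁻¹), _root_.mul_one, coeff_pointsEquiv]
  intro a _
  rw [eq_mul_inv_iff_mul_eq]

lemma isNormalFamily_coords :
    IsNormalFamily (fun s => ((translation S 𝔤 s).hom.left).appTop.hom)
      (coords (𝟙 (unitGroup S 𝔤))) where
  map_apply s t := by
    rw [← coords_comp_translation, Category.id_comp, ← coords_comp, Category.comp_id]
  isUnit_det := isUnit_det_coords _

lemma translation_whiskerRight_mul (s : 𝔤) :
    (translation S 𝔤 s).hom ▷ unitGroup S 𝔤 ≫ μ = μ ≫ (translation S 𝔤 s).hom := by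
  rw [comp_translation, MonObj.mul_eq_mul, MonObj.comp_mul, whiskerRight_fst, whiskerRight_snd,
    comp_translation, mul_right_comm]

lemma translation_whiskerLeft_mul (s : 𝔤) :
    unitGroup S 𝔤 ◁ (translation S 𝔤 s).hom ≫ μ = μ ≫ (translation S 𝔤 s).hom := by
  rw [comp_translation, MonObj.mul_eq_mul, MonObj.comp_mul, whiskerLeft_fst, whiskerLeft_snd,
    comp_translation, _root_.mul_assoc]

lemma translation_inv (s : 𝔤) :
    (translation S 𝔤 s).hom ≫ ι = ι ≫ (translation S 𝔤 s⁻¹).hom := by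
  rw [comp_translation, map_inv, GrpObj.inv_eq_inv, GrpObj.comp_inv, GrpObj.comp_inv,
    Category.comp_id, ← _root_.mul_inv, ← comp_translation, Category.id_comp]

lemma translation_injective [Nonempty S] : Function.Injective (translation S 𝔤) := by
  intro s t hst
  have h1 (r : 𝔤) : coords η[unitGroup S 𝔤] r = if r = 1 then 1 else 0 := by
    rw [← coeff_pointsEquiv, MonObj.one_eq_one, map_one, Units.val_one, MonoidAlgebra.one_def]
    simp [Finsupp.single_apply, eq_comm]
  have h := coords_comp_translation S 𝔤 η s s
  rw [hst, coords_comp_translation, mul_inv_cancel, h1, h1, if_pos rfl] at h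
  have : Nonempty (⊤ : (𝟙_ (Over S)).left.Opens) := ⟨⟨(inferInstance : Nonempty S).some, trivial⟩⟩
  have : Nontrivial Γ((𝟙_ (Over S)).left, ⊤) := Scheme.component_nontrivial _ ⊤
  exact eq_of_mul_inv_eq_one (by_contra fun hne => one_ne_zero ((if_neg hne).symm.trans h).symm)

end UnitGroup
end GroupAlgebra

/-! ### The isogeny from the unit group to its quotient. -/

namespace GroupAlgebra

/-- The Artin–Tate lemma; it makes the quotient of finite type over `k`. -/
lemma _root_.RingHom.FiniteType.of_comp_of_finite {A B C : Type*} [CommRing A] [CommRing B]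
    [CommRing C] [IsNoetherianRing A] {f : A →+* B} {g : B →+* C} (h : (g.comp f).FiniteType)
    (hg : g.Finite) (hi : Function.Injective g) : f.FiniteType := by
  algebraize [f, g, g.comp f]
  have h1 : Algebra.FiniteType A C := h
  have h2 : Module.Finite B C := hg
  exact ⟨fg_of_fg_of_fg A B C h1.out h2.fg_top hi⟩

variable (k : Type u) [Field k] (𝔤 : Type u) [CommGroup 𝔤] [Fintype 𝔤] [DecidableEq 𝔤]

instance : LocallyOfFiniteType (unitGroup (Spec (.of k)) 𝔤).hom :=
  inferInstanceAs (LocallyOfFiniteType ((𝔸(𝔤; Spec (.of k)).basicOpen _).ι ≫ _))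

open AlgebraicVariety

lemma isVariety_of_isAffine {X : Over (Spec (.of k))} [IsAffine X.left] [IsReduced X.left]
    [LocallyOfFiniteType X.hom] : IsVariety X where
  isReduced := inferInstance
  isSeparated := inferInstance
  locallyOfFiniteType := inferInstance
  quasiCompact := inferInstance

variable {k 𝔤} in
lemma IsNormalQuotient.isIsogeny {G : Over (Spec (.of k))} [GrpObj G]
    {θ : unitGroup (Spec (.of k)) 𝔤 ⟶ G} [IsMonHom θ] [IsCommMonObj G]
    (h : IsNormalQuotient (fun s => (translation (Spec (.of k)) 𝔤 s).hom.left) θ.left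
      (coords (𝟙 _))) : IsIsogeny θ := by
  have := h.isFinite
  have := h.surjective
  have := h.isAffine_target
  have hinj := h.isInvariantRing.injective
  have : IsIntegral G.left := by
    have : IsDomain Γ(G.left, ⊤) := hinj.isDomain θ.left.appTop.hom
    have : Nonempty G.left := Nonempty.map θ.left inferInstance
    exact isIntegral_of_isAffine_of_isDomain _
  have : LocallyOfFiniteType G.hom := by
    have : IsNoetherianRing Γ(Spec (.of k), ⊤) :=
      isNoetherianRing_of_ringEquiv k (Scheme.ΓSpecIso (.of k)).commRingCatIsoToRingEquiv.symm
    have h1 := HasRingHomProperty.appTop (P := @LocallyOfFiniteType)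
      (unitGroup (Spec (.of k)) 𝔤).hom inferInstance
    rw [← Over.w θ, Scheme.Hom.comp_appTop, CommRingCat.hom_comp] at h1
    rw [HasRingHomProperty.iff_of_isAffine (P := @LocallyOfFiniteType)]
    exact .of_comp_of_finite h1 h.isBasisOver.finite hinj
  exact
  { source := ⟨inferInstance, isVariety_of_isAffine k, inferInstance⟩
    target := ⟨inferInstance, isVariety_of_isAffine k, inferInstance⟩
    isMonHom := inferInstance
    surjective := inferInstance
    finite_kernel := inferInstance }

variable {k 𝔤} in
lemma IsNormalQuotient.isQuotientBy {X Y : Over (Spec (.of k))} {ρ : 𝔤 →* Aut X} {p : X ⟶ Y}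
    {x : 𝔤 → Γ(X.left, ⊤)} (h : IsNormalQuotient (fun s => (ρ s).hom.left) p.left x) :
    IsQuotientBy ρ p where
  isAffineHom := by
    have := h.isFinite
    infer_instance
  invariant s := Over.OverMorphism.ext (h.comp_eq s)
  injective_app := h.injective_app
  range_app U := by
    ext b
    rw [h.mem_range_app_iff]
    exact forall_congr' fun s => ⟨fun e => ⟨_, e⟩, fun ⟨_, e⟩ => e⟩

variable {k 𝔤} in
lemma IsNormalQuotient.isGaloisCovering {G : Over (Spec (.of k))}
    {θ : unitGroup (Spec (.of k)) 𝔤 ⟶ G}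
    (h : IsNormalQuotient (fun s => (translation (Spec (.of k)) 𝔤 s).hom.left) θ.left
      (coords (𝟙 _))) : IsGaloisCovering (translation (Spec (.of k)) 𝔤) θ where
  isQuotientBy := h.isQuotientBy
  injective := translation_injective _ _
  surjective α hα := by
    let A := Γ((unitGroup (Spec (.of k)) 𝔤).left, ⊤)
    have hφ : Function.Injective fun s => (translation (Spec (.of k)) 𝔤 s).hom.left.appTop.hom := by
      intro s t hst
      apply translation_injective (Spec (.of k)) 𝔤
      ext1
      ext1
      apply ext_of_isAffine
      ext1
      exact hst
    let e : A ≃+* A := 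
      (Scheme.Γ.mapIso ((Over.forget _).mapIso α).op).commRingCatIsoToRingEquiv
    obtain ⟨s, hs⟩ := h.isInvariantRing.exists_eq_of_comp_eq hφ (by simp; rfl) (fun s t => by
      rw [mul_comm, map_mul]
      rfl) e fun a => by
        have := congrArg (fun f => f.left.appTop.hom a) hα
        rw [Over.comp_left, Scheme.Hom.comp_appTop] at this
        exact this
    refine ⟨s, ?_⟩
    ext1
    ext1
    apply ext_of_isAffine
    ext1
    exact hs

/-- The quotient of the group of units of the group algebra by `𝔤`. -/
theorem exists_isIsogeny_isNormalQuotient :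
    ∃ (G : Over (Spec (.of k))) (_ : GrpObj G) (θ : unitGroup (Spec (.of k)) 𝔤 ⟶ G),
      IsIsogeny θ ∧ IsNormalQuotient (fun s => (translation (Spec (.of k)) 𝔤 s).hom.left) θ.left
        (coords (𝟙 _)) := by
  obtain ⟨Y, p, h⟩ := exists_isNormalQuotient
    (σ := fun s => (translation (Spec (.of k)) 𝔤 s).hom.left) (by simp; rfl) (fun s t => by
      rw [mul_comm, map_mul]
      rfl) (isNormalFamily_coords (Spec (.of k)) 𝔤)
  obtain ⟨q, hq⟩ := h.exists_desc (unitGroup (Spec (.of k)) 𝔤).hom fun s => Over.w _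
  let G := Over.mk q
  let θ : unitGroup (Spec (.of k)) 𝔤 ⟶ G := Over.homMk p hq
  have h' : IsNormalQuotient (fun s => (translation (Spec (.of k)) 𝔤 s).hom.left) θ.left
      (coords (𝟙 _)) := h
  have hθ (s : 𝔤) : (translation (Spec (.of k)) 𝔤 s).hom ≫ θ = θ :=
    Over.OverMorphism.ext (h.comp_eq s)
  obtain ⟨hG, _, _⟩ := h'.exists_grpObj (translation_whiskerRight_mul _ _)
    (translation_whiskerLeft_mul _ _) fun s => by
      rw [← Category.assoc, translation_inv, Category.assoc, hθ]
  exact ⟨G, hG, θ, h'.isIsogeny, h'⟩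

end GroupAlgebra

namespace GroupAlgebra

/-! ### Reduced rings whose invariants form a domain. -/

section InvariantRing

variable {𝔤 : Type*} [CommGroup 𝔤] {R S : Type*} [CommRing R] [CommRing S] [IsDomain S]
  [IsReduced R] {φ : 𝔤 → R →+* R} {i : S →+* R}

/-- With `P` over `0`, `i c` is invariant and outside `P`, so every conjugate of `d` lies in `P`. -/
lemma IsInvariantRing.eq_zero_of_mul_eq_zero [Finite 𝔤] (hi : IsInvariantRing φ i)
    (h1 : φ 1 = RingHom.id R) (hmul : ∀ s t, φ (s * t) = (φ s).comp (φ t)) {c : S} (hc : c ≠ 0)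
    {d : R} (hcd : i c * d = 0) : d = 0 := by
  let _ : MulSemiringAction 𝔤 R := MulSemiringAction.compHom R
    ({ toFun := φ, map_one' := h1, map_mul' := hmul } : 𝔤 →* (R →+* R))
  algebraize [i]
  have : FaithfulSMul S R := (faithfulSMul_iff_algebraMap_injective S R).2 hi.injective
  have : Algebra.IsInvariant S R 𝔤 := ⟨fun a ha => (hi.mem_range_iff _).2 ha⟩
  obtain ⟨P, hP, hPS⟩ := exists_isPrime_comap_eq_bot 𝔤 (A := S) (R := R)
  refine eq_zero_of_forall_smul_mem (A := S) (G := 𝔤) P hPS d fun s => ?_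
  have h0 : i c * s • d = 0 := by
    rw [← smul_zero s, ← hcd, smul_mul']
    congr 1
    exact ((hi.mem_range_iff _).1 ⟨c, rfl⟩ s).symm
  refine (hP.mem_or_mem (h0 ▸ P.zero_mem : i c * s • d ∈ P)).resolve_left fun h => hc ?_
  have : c ∈ P.comap (algebraMap S R) := h
  rwa [hPS] at this

lemma IsInvariantRing.exists_det_ne_zero [Fintype 𝔤] [DecidableEq 𝔤] (hi : IsInvariantRing φ i)
    (hφ : Function.Injective φ) (h1 : φ 1 = RingHom.id R)
    (hmul : ∀ s t, φ (s * t) = (φ s).comp (φ t)) : ∃ x : R, det (fun s => φ s⁻¹ x) ≠ 0 := by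
  let _ : MulSemiringAction 𝔤 R := MulSemiringAction.compHom R
    ({ toFun := φ, map_one' := h1, map_mul' := hmul } : 𝔤 →* (R →+* R))
  algebraize [i]
  have : FaithfulSMul S R := (faithfulSMul_iff_algebraMap_injective S R).2 hi.injective
  have : Algebra.IsInvariant S R 𝔤 := ⟨fun a ha => (hi.mem_range_iff _).2 ha⟩
  have : FaithfulSMul 𝔤 R := ⟨fun {s t} h => hφ (RingHom.ext h)⟩
  have : SMulCommClass 𝔤 S R := ⟨fun s a b => by
    rw [Algebra.smul_def, Algebra.smul_def, smul_mul']
    congr 1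
    exact (hi.mem_range_iff _).1 ⟨a, rfl⟩ s⟩
  exact exists_det_smul_ne_zero (A := S)

end InvariantRing

end GroupAlgebra

/-! ### Sections and dense open subsets for quotients of varieties. -/

namespace AlgebraicVariety
open GroupAlgebra

variable {k : Type u} [Field k] {𝔤 : Type*} [CommGroup 𝔤] {W V : Over (Spec (.of k))}
  {ρ : 𝔤 →* Aut W} {π : W ⟶ V}

namespace IsQuotientBy

lemma comp_eq (hπ : IsQuotientBy ρ π) (s : 𝔤) : (ρ s).hom.left ≫ π.left = π.left :=
  congrArg CommaMorphism.left (hπ.invariant s)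

/-- The action on the functions on the inverse image of an open subset. -/
noncomputable def sectionAction (hπ : IsQuotientBy ρ π) (U : V.left.Opens) (s : 𝔤) :
    Γ(W.left, π.left ⁻¹ᵁ U) →+* Γ(W.left, π.left ⁻¹ᵁ U) :=
  ((ρ s).hom.left.appLE _ _ (preimage_le_of_comp_eq (hπ.comp_eq s) U)).hom

lemma sectionAction_one (hπ : IsQuotientBy ρ π) (U : V.left.Opens) :
    hπ.sectionAction U 1 = RingHom.id _ := by
  have key (q : W.left ⟶ W.left) (hq : q = 𝟙 _) (O : W.left.Opens) (e : O ≤ q ⁻¹ᵁ O) :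
      q.appLE O O e = 𝟙 _ := by
    subst hq
    rw [Scheme.Hom.appLE, Scheme.Hom.id_app]
    exact (Category.id_comp _).trans (W.left.presheaf.map_id _)
  exact congrArg CommRingCat.Hom.hom (key _ (by rw [map_one]; rfl) _ _)

lemma sectionAction_mul (hπ : IsQuotientBy ρ π) (U : V.left.Opens) (s t : 𝔤) :
    hπ.sectionAction U (s * t) = (hπ.sectionAction U s).comp (hπ.sectionAction U t) := by
  have key (q q' r : W.left ⟶ W.left) (hq : r = q ≫ q') (O : W.left.Opens) (e : O ≤ r ⁻¹ᵁ O)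
      (e' : O ≤ q ⁻¹ᵁ O) (e'' : O ≤ q' ⁻¹ᵁ O) :
      r.appLE O O e = q'.appLE O O e'' ≫ q.appLE O O e' := by
    subst hq
    rw [Scheme.Hom.appLE_comp_appLE]
  -- Pullback of functions reverses the order; commutativity of `𝔤` restores it.
  exact congrArg CommRingCat.Hom.hom (key _ _ _ (by rw [mul_comm, map_mul]; rfl) _ _ _ _)

lemma isInvariantRing (hπ : IsQuotientBy ρ π) (U : V.left.Opens) :
    IsInvariantRing (hπ.sectionAction U) (π.left.app U).hom where
  injective := hπ.injective_app U
  mem_range_iff a := by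
    refine (Set.ext_iff.1 (hπ.range_app U) a).trans ?_
    exact forall_congr' fun s => ⟨fun ⟨_, e⟩ => e, fun e => ⟨_, e⟩⟩

lemma isInvariantRing_restrictEnd (hπ : IsQuotientBy ρ π) (U : V.left.Opens) :
    IsInvariantRing (fun s => (restrictEnd (hπ.comp_eq s) U).appTop.hom)
      (π.left ∣_ U).appTop.hom :=
  (isInvariantRing_restrictEnd_iff hπ.comp_eq U).2
    ⟨(hπ.isInvariantRing U).injective, (hπ.isInvariantRing U).mem_range_iff⟩

/-- If `D(e)` missed the preimage of a nonempty `D(c)`, then `c * e` would vanish, although nonzero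
functions on `V` are not zero divisors on `W`. -/
lemma dense_preimage [Finite 𝔤] (hπ : IsQuotientBy ρ π) [IsReduced W.left] [IsIntegral V.left]
    {U : V.left.Opens} (hU : (U : Set V.left).Nonempty) :
    Dense ((π.left ⁻¹ᵁ U : W.left.Opens) : Set W.left) := by
  have := hπ.isAffineHom
  rw [dense_iff_inter_open]
  rintro O hO ⟨w, hw⟩
  obtain ⟨_, ⟨V₁, hV₁, rfl⟩, hwV, -⟩ := V.left.isBasis_affineOpens.exists_subset_of_mem_open
    (Set.mem_univ (π.left w)) isOpen_univ
  obtain ⟨e, heO, hwe⟩ := (hV₁.preimage π.left).exists_basicOpen_le (V := ⟨O, hO⟩) ⟨w, hw⟩ hwV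
  obtain ⟨v, hvU, hvV⟩ : ((U : Set V.left) ∩ V₁).Nonempty :=
    nonempty_preirreducible_inter U.2 V₁.2 hU ⟨_, hwV⟩
  obtain ⟨c, hcU, hvc⟩ := hV₁.exists_basicOpen_le (V := U) ⟨v, hvU⟩ hvV
  have : Nonempty V₁ := ⟨⟨_, hwV⟩⟩
  have hc : c ≠ 0 := by
    rintro rfl
    rw [Scheme.basicOpen_zero] at hvc
    exact hvc
  by_contra hne
  have h0 : W.left.basicOpen (π.left.app V₁ c * e) = ⊥ := by
    rw [Scheme.basicOpen_mul, ← Scheme.preimage_basicOpen, eq_bot_iff]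
    rintro y ⟨hy, hye⟩
    exact hne ⟨y, heO hye, hcU hy⟩
  rw [basicOpen_eq_bot_iff] at h0
  have he := (hπ.isInvariantRing V₁).eq_zero_of_mul_eq_zero (hπ.sectionAction_one V₁)
    (hπ.sectionAction_mul V₁) hc h0
  rw [he, Scheme.basicOpen_zero] at hwe
  exact hwe

/-- Automorphisms that agree on a dense open subset agree, as `W` is reduced and separated. -/
lemma sectionAction_injective [Finite 𝔤] (hπ : IsQuotientBy ρ π) (hρ : Function.Injective ρ)
    [IsReduced W.left] [IsSeparated W.hom] [IsIntegral V.left]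
    {U : V.left.Opens} (hU : IsAffineOpen U) (hne : (U : Set V.left).Nonempty) :
    Function.Injective (hπ.sectionAction U) := by
  intro s t hst
  have := hπ.isAffineHom
  apply hρ
  ext1
  ext1
  have : IsDominant (π.left ⁻¹ᵁ U).ι := ⟨by
    simpa [DenseRange] using hπ.dense_preimage hne⟩
  refine ext_of_isDominant_of_isSeparated W.hom ?_ (π.left ⁻¹ᵁ U).ι ?_
  · rw [Over.w, Over.w]
  · rw [← restrictEnd_ι (hπ.comp_eq s), ← restrictEnd_ι (hπ.comp_eq t)]
    congr 1
    have : IsAffine (π.left ⁻¹ᵁ U) := hU.preimage π.left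
    apply ext_of_isAffine
    have h (s : 𝔤) : (restrictEnd (hπ.comp_eq s) U).appTop = _ := Scheme.Hom.resLE_app_top _ _
    rw [h, h]
    congr 2
    exact CommRingCat.hom_ext hst

end IsQuotientBy
end AlgebraicVariety

/-! ### Generic normal bases and the main theorem. -/

namespace AlgebraicVariety
open GroupAlgebra

variable {k : Type u} [Field k] {𝔤 : Type u} [CommGroup 𝔤] [Fintype 𝔤] [DecidableEq 𝔤]
  {W V : Over (Spec (.of k))} {ρ : 𝔤 →* Aut W} {π : W ⟶ V}

/-- Over some dense open subset, a quotient by a faithful action admits a normal basis. -/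
lemma IsQuotientBy.exists_isNormalQuotient (hπ : IsQuotientBy ρ π) (hρ : Function.Injective ρ)
    [IsReduced W.left] [IsSeparated W.hom] [IsIntegral V.left] :
    ∃ (U : V.left.Opens) (v : 𝔤 → Γ((π.left ⁻¹ᵁ U).toScheme, ⊤)), (U : Set V.left).Nonempty ∧
      IsNormalQuotient (fun s => restrictEnd (hπ.comp_eq s) U) (π.left ∣_ U) v := by
  have := hπ.isAffineHom
  obtain ⟨y⟩ : Nonempty V.left := inferInstance
  obtain ⟨_, ⟨U₀, hU₀, rfl⟩, hy, -⟩ := V.left.isBasis_affineOpens.exists_subset_of_mem_open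
    (Set.mem_univ y) isOpen_univ
  have : Nonempty U₀ := ⟨⟨y, hy⟩⟩
  let φ := hπ.sectionAction U₀
  have hi := hπ.isInvariantRing U₀
  have hmul := hπ.sectionAction_mul U₀
  obtain ⟨x, hx⟩ := hi.exists_det_ne_zero (hπ.sectionAction_injective hρ hU₀ ⟨y, hy⟩)
    (hπ.sectionAction_one U₀) hmul
  -- The determinant itself may change sign under `𝔤`; its square descends to `c`, and inverting `c`
  -- inverts the determinant.
  obtain ⟨c, hc⟩ := (hi.mem_range_iff _).2 <| IsNormalFamily.map_det_sq (φ := φ)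
    (x := fun s => φ s⁻¹ x) fun s t => by
      rw [← RingHom.comp_apply, ← hmul, mul_inv_rev, inv_inv]
  have hc0 : c ≠ 0 := by
    rintro rfl
    rw [map_zero] at hc
    exact hx (eq_zero_of_pow_eq_zero hc.symm)
  let U := V.left.basicOpen c
  have hUU₀ : U ≤ U₀ := V.left.basicOpen_le c
  have hU : IsAffineOpen U := hU₀.basicOpen c
  have : IsAffine U := hU
  have : IsAffine (π.left ⁻¹ᵁ U) := hU.preimage π.left
  have hle : ⊤ ≤ (π.left ⁻¹ᵁ U).ι ⁻¹ᵁ (π.left ⁻¹ᵁ U₀) := by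
    rw [← Scheme.Opens.ι_preimage_self]
    exact Scheme.Hom.preimage_mono _ (π.left.preimage_mono hUU₀)
  let r : Γ(W.left, π.left ⁻¹ᵁ U₀) ⟶ Γ((π.left ⁻¹ᵁ U).toScheme, ⊤) :=
    (π.left ⁻¹ᵁ U).ι.appLE (π.left ⁻¹ᵁ U₀) ⊤ hle
  have hr (s : 𝔤) (a) : (restrictEnd (hπ.comp_eq s) U).appTop (r a) = r (φ s a) := by
    have key {X Y : Scheme.{u}} (p q : X ⟶ Y) (hpq : p = q) (A : Y.Opens) (B : X.Opens) (h) (h') :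
      p.appLE A B h = q.appLE A B h' := by subst hpq; rfl
    have h := key _ _ (restrictEnd_ι (hπ.comp_eq s) U) (π.left ⁻¹ᵁ U₀) ⊤
      (by rw [Scheme.Hom.comp_preimage]; exact Scheme.Hom.preimage_mono _ hle)
      (by
        rw [Scheme.Hom.comp_preimage, ← Scheme.Hom.comp_preimage _ π.left, hπ.comp_eq]
        exact hle)
    rw [← Scheme.Hom.appLE_comp_appLE _ _ _ ⊤ _ hle le_top,
      ← Scheme.Hom.appLE_comp_appLE _ _ _ (π.left ⁻¹ᵁ U₀) _
        (by rw [← Scheme.Hom.comp_preimage, hπ.comp_eq]) hle] at h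
    rw [Scheme.Hom.appTop, Scheme.Hom.app_eq_appLE]
    exact ConcreteCategory.congr_hom h a
  have hunit : IsUnit (r (π.left.app U₀ c)) := by
    rw [← basicOpen_eq_top_iff, Scheme.basicOpen_appLE, ← Scheme.preimage_basicOpen,
      Scheme.Opens.ι_preimage_self, top_inf_eq]
  refine ⟨U, fun s => r (φ s⁻¹ x), ?_, .of_isInvariantRing ?_ ?_
    (hπ.isInvariantRing_restrictEnd U) ⟨fun s t => ?_, ?_⟩⟩
  · rwa [← TopologicalSpace.Opens.ne_bot_iff_nonempty, Ne, basicOpen_eq_bot_iff]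
  · rw [← cancel_mono (π.left ⁻¹ᵁ U).ι, restrictEnd_ι, Category.id_comp, map_one]
    exact Category.comp_id _
  · intro s t
    rw [← cancel_mono (π.left ⁻¹ᵁ U).ι, Category.assoc, restrictEnd_ι, restrictEnd_ι,
      restrictEnd_ι_assoc, mul_comm, map_mul]
    rfl
  · change (restrictEnd (hπ.comp_eq t) U).appTop _ = _
    rw [hr]
    congr 1
    rw [← RingHom.comp_apply, ← hmul, mul_inv_rev, inv_inv]
  · have hd : r.hom (det fun s => φ s⁻¹ x) = det fun s => r (φ s⁻¹ x) := map_det _ _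
    rw [← hd, ← isUnit_pow_iff two_ne_zero, ← map_pow, ← hc]
    exact hunit

end AlgebraicVariety

open AlgebraicVariety GroupAlgebra in
theorem mainTheorem7 {k : Type u} [Field k] [PerfectField k]
    {𝔤 : Type u} [CommGroup 𝔤] [Fintype 𝔤] [DecidableEq 𝔤]
    {W V : Over (Spec (.of k))}
    (hW : AlgebraicVariety.IsVariety W) (hV : AlgebraicVariety.IsVariety V) [IrreducibleSpace V.left]
    (ρ : 𝔤 →* Aut W) (hρ : Function.Injective ρ)
    (π : W ⟶ V) (hπ : AlgebraicVariety.IsQuotientBy ρ π) :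
    ∃ (G : Over (Spec (.of k))) (_ : GrpObj G)
      (θ : GroupAlgebra.unitGroup (Spec (.of k)) 𝔤 ⟶ G),
      AlgebraicVariety.IsIsogeny θ ∧
      AlgebraicVariety.IsGaloisCovering (GroupAlgebra.translation (Spec (.of k)) 𝔤) θ ∧
      ∃ (f : V.left ⤏ G.left) (g : W.left ⤏ (GroupAlgebra.unitGroup (Spec (.of k)) 𝔤).left),
        f.IsOver (Spec (.of k)) ∧ g.IsOver (Spec (.of k)) ∧
        AlgebraicVariety.IsRationalPullback ρ
          (GroupAlgebra.translation (Spec (.of k)) 𝔤) π θ g f := by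
  have := hW.isReduced
  have := hW.isSeparated
  have := hV.isReduced
  have : IsIntegral V.left := isIntegral_of_irreducibleSpace_of_isReduced _
  obtain ⟨G, hG, θ, hθ, hN⟩ := exists_isIsogeny_isNormalQuotient k 𝔤
  refine ⟨G, hG, θ, hθ, hN.isGaloisCovering, ?_⟩
  have := hN.isAffine_target
  obtain ⟨U, v, hU, hv⟩ := hπ.exists_isNormalQuotient hρ
  have hUd : Dense (U : Set V.left) := U.2.dense hU
  have hUd' := hπ.dense_preimage hU
  let T : Over (Spec (.of k)) := Over.mk ((π.left ⁻¹ᵁ U).ι ≫ W.hom)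
  let g : T ⟶ unitGroup (Spec (.of k)) 𝔤 := ofCoords (T := T) v hv.isNormalFamily.isUnit_det
  -- `g` pulls the universal normal basis back to `v`, which is what makes the square cartesian.
  have hg : g.left.appTop.hom ∘ coords (𝟙 _) = v := by
    rw [← coords_ofCoords (T := T) v hv.isNormalFamily.isUnit_det]
    funext s
    exact ((coords_comp g (𝟙 _) s).symm.trans (by rw [Category.comp_id]))
  let e (s : 𝔤) : T ⟶ T := Over.homMk (restrictEnd (hπ.comp_eq s) U) (by
    change _ ≫ _ ≫ _ = _ ≫ _
    rw [restrictEnd_ι_assoc, Over.w])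
  have he (s : 𝔤) : e s ≫ g = g ≫ (translation (Spec (.of k)) 𝔤 s).hom := by
    apply coords_injective
    funext t
    rw [coords_comp, coords_comp_translation, coords_ofCoords]
    exact hv.isNormalFamily.map_apply t s
  have he' (s : 𝔤) : restrictEnd (hπ.comp_eq s) U ≫ g.left =
      g.left ≫ (translation (Spec (.of k)) 𝔤 s).hom.left := congrArg CommaMorphism.left (he s)
  -- By equivariance of `g`, the composite with `θ` is invariant and factors through `U`.
  obtain ⟨f, hf⟩ := hv.exists_desc (g.left ≫ θ.left) fun s => by
    rw [reassoc_of% he', hN.comp_eq]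
  have hfk : f ≫ G.hom = U.ι ≫ V.hom := by
    apply hv.hom_ext
    rw [reassoc_of% hf, Over.w, Over.w, morphismRestrict_ι_assoc, Over.w]
    rfl
  refine ⟨Scheme.PartialMap.toRationalMap ⟨U, hUd, f⟩,
    Scheme.PartialMap.toRationalMap ⟨π.left ⁻¹ᵁ U, hUd', g.left⟩, ?_, ?_,
    U, hUd, hUd', f, g.left, rfl, rfl, hN.isPullback (hg ▸ hv) hf.symm, fun s => ⟨_, he' s⟩⟩
  · exact ⟨⟨_, ⟨hfk⟩, rfl⟩⟩
  · exact ⟨⟨_, ⟨Over.w g⟩, rfl⟩⟩
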